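/- **Setting.** Let $n\ge 1$, $b>1$, $A>0$, and let all functions on $\mathbb{R}^n$ take values in $\mathbb{K}=\mathbb{R}$ or $\mathbb{K}=\mathbb{C}$. Let $\Phi_1$ be the set of smooth functions $\phi$ with $\operatorname{supp}\phi\subset B(0,1)$ and $\sup|\nabla\phi|\le A$, and put $\phi_t(y)=t^{-n}\phi(y/t)$. For a locally integrable $f$ on $\mathbb{R}^n$ let $$\mathcal{M}f(x)=\sup\{|f*\phi_t(y)| : \phi\in\Phi_1,\ t>0,\ |y-x|<bt\}.$$ The space $H^1$ consists of the locally integrable $f$ with $\|f\|_{H^1}:=\|\mathcal{M}f\|_1<\infty$. A $(1,\infty)$-atom is a measurable function $a$ for which there is a ball $B$ with $\operatorname{supp}a\subset B$, $\|a\|_\infty\le|B|^{-1}$ and $\int_B a=0$. The space $H^{1,\infty}_{\mathrm{at}}$ consists of the $f\in L^1$ that can be written as $f=\sum_j\lambda_ja_j$ in $L^1$, with $(1,\infty)$-atoms $a_j$ and $\sum_j|\lambda_j|<\infty$; its norm is the infimum of $\sum_j|\lambda_j|$ over all such decompositions. **Proposition 6.7.** There is a continuous inclusion $H^1\subset H^{1,\infty}_{\mathrm{at}}$: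 there is a constant $C$ such that every $f\in H^1$ belongs to $H^{1,\infty}_{\mathrm{at}}$ and $\|f\|_{H^{1,\infty}_{\mathrm{at}}}\le C\|\mathcal{M}f\|_1$. More precisely, there exist constants $0<c_s<c_s'<1$, $N\in\mathbb{N}$ and $C,C'>0$, none of which depends on $f$ or $m$, such that every $f\in H^1$ has a decomposition $$f=\sum_{m\in\mathbb{Z}}\sum_{j\in J^{(m)}}b_j^{(m)}=\sum_{m,j}\lambda_j^{(m)}a_j^{(m)},$$ converging unconditionally in $L^1$, with countable (possibly empty) index sets $J^{(m)}$ and with the following properties, where $O^{(m)}=\{\mathcal{M}f>2^m\}$. 1. Each $b_j^{(m)}$ is supported in the ball $B(x_j^{(m)},c_sd_j^{(m)})$ for some $x_j^{(m)}\in O^{(m)}$, where $d_j^{(m)}=\operatorname{dist}(x_j^{(m)},\mathbb{R}^n\setminus O^{(m)})$. 2. $|b_j^{(m)}|\le C2^m$. 3. The functions $a_j^{(m)}:=(\lambda_j^{(m)})^{-1}b_j^{(m)}$ are $(1,\infty)$-atoms. 4. The coefficients are $\lambda_j^{(m)}=C'2^m(d_j^{(m)})^n>0$, and $\sum_{m,j}\lambda_j^{(m)}\le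 C\|\mathcal{M}f\|_1$. 5. For each fixed $m$, every point of $\mathbb{R}^n$ lies in at most $N$ of the balls $B(x_j^{(m)},c_s'd_j^{(m)})$, $j\in J^{(m)}$. Moreover, if $f$ is continuous, then every atom $a_j^{(m)}$ of this decomposition is continuous. If $f\in L^p$ for some $1<p<\infty$, then the decomposition also converges (unconditionally) in $L^p$. -/

import Mathlib

open MeasureTheory Filter Topology
open scoped ENNReal ContDiff

noncomputable section

namespace HardyAtomic

/-- The class of test functions: smooth functions with support in the open unit ball whose
`C^1`-seminorm (the supremum of the norm of the differential) is at most `A`. -/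
def testClass (𝕜 : Type*) [RCLike 𝕜] (n : ℕ) (A : ℝ) : Set (EuclideanSpace ℝ (Fin n) → 𝕜) :=
  {φ | ContDiff ℝ ∞ φ ∧ tsupport φ ⊆ Metric.ball 0 1 ∧ ∀ x, ‖fderiv ℝ φ x‖ ≤ A}

/-- The `L^1`-normalized dilate `φ_t(y) = t^{-n} φ(y/t)`. -/
def dilate {𝕜 : Type*} [RCLike 𝕜] {n : ℕ} (φ : EuclideanSpace ℝ (Fin n) → 𝕜) (t : ℝ) :
    EuclideanSpace ℝ (Fin n) → 𝕜 :=
  fun y => (t ^ n)⁻¹ • φ (t⁻¹ • y)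

/-- The non-tangential grand maximal function with aperture `b`:
the supremum of `|f * φ_t (y)|` over test functions `φ`, over `t > 0` and over `|y - x| < b t`. -/
def grandMaximal {𝕜 : Type*} [RCLike 𝕜] {n : ℕ} (A b : ℝ)
    (f : EuclideanSpace ℝ (Fin n) → 𝕜) (x : EuclideanSpace ℝ (Fin n)) : ℝ≥0∞ :=
  ⨆ (φ : EuclideanSpace ℝ (Fin n) → 𝕜) (_ : φ ∈ testClass 𝕜 n A) (t : ℝ) (_ : 0 < t)
    (y : EuclideanSpace ℝ (Fin n)) (_ : dist y x < b * t),
    ‖convolution f (dilate φ t) (ContinuousLinearMap.mul 𝕜 𝕜) volume y‖ₑ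

/-- The Hardy space norm: the `L^1` norm of the grand maximal function. -/
def hardyNorm {𝕜 : Type*} [RCLike 𝕜] {n : ℕ} (A b : ℝ)
    (f : EuclideanSpace ℝ (Fin n) → 𝕜) : ℝ≥0∞ :=
  ∫⁻ x, grandMaximal A b f x

/-- Membership in the Hardy space `H^1` (maximal definition). Local integrability is what makes
the convolutions `f * φ_t` meaningful. -/
def MemHardy {𝕜 : Type*} [RCLike 𝕜] {n : ℕ} (A b : ℝ)
    (f : EuclideanSpace ℝ (Fin n) → 𝕜) : Prop :=
  LocallyIntegrable f volume ∧ hardyNorm A b f < ⊤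

/-- The superlevel set `{M f > 2^m}`. -/
def levelSet {𝕜 : Type*} [RCLike 𝕜] {n : ℕ} (A b : ℝ)
    (f : EuclideanSpace ℝ (Fin n) → 𝕜) (m : ℤ) : Set (EuclideanSpace ℝ (Fin n)) :=
  {x | (2 : ℝ≥0∞) ^ m < grandMaximal A b f x}

/-- The distance of `x` to the complement of the superlevel set `{M f > 2^m}`. -/
def distCompl {𝕜 : Type*} [RCLike 𝕜] {n : ℕ} (A b : ℝ)
    (f : EuclideanSpace ℝ (Fin n) → 𝕜) (m : ℤ) (x : EuclideanSpace ℝ (Fin n)) : ℝ :=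
  Metric.infDist x (levelSet A b f m)ᶜ

/-- `(1, q)`-atoms, `1 < q ≤ ∞`: functions `a` supported in a ball `B` with
`‖a‖_q ≤ |B|^{-1 + 1/q}` and `∫_B a = 0`. -/
def IsAtom {𝕜 : Type*} [RCLike 𝕜] {n : ℕ} (q : ℝ≥0∞)
    (a : EuclideanSpace ℝ (Fin n) → 𝕜) : Prop :=
  AEStronglyMeasurable a volume ∧
  ∃ (z : EuclideanSpace ℝ (Fin n)) (r : ℝ), 0 < r ∧
    tsupport a ⊆ Metric.ball z r ∧
    eLpNorm a q volume ≤ volume (Metric.ball z r) ^ (-1 + (q⁻¹).toReal) ∧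
    ∫ x in Metric.ball z r, a x = 0

/-- `f = ∑ j, lam j * a j` in `L^1`, with `(1, q)`-atoms `a j` and an absolutely summable
sequence `lam`. -/
def IsAtomicDecomposition {𝕜 : Type*} [RCLike 𝕜] {n : ℕ} (q : ℝ≥0∞)
    (f : EuclideanSpace ℝ (Fin n) → 𝕜) (lam : ℕ → 𝕜)
    (a : ℕ → EuclideanSpace ℝ (Fin n) → 𝕜) : Prop :=
  (∀ j, IsAtom q (a j)) ∧ Summable (fun j => ‖lam j‖) ∧
  Tendsto (fun k : ℕ => eLpNorm (fun x => f x - ∑ j ∈ Finset.range k, lam j * a j x) 1 volume)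
    atTop (𝓝 0)

/-- Membership in the atomic Hardy space `H^{1,q}_at`. -/
def MemAtomicHardy {𝕜 : Type*} [RCLike 𝕜] {n : ℕ} (q : ℝ≥0∞)
    (f : EuclideanSpace ℝ (Fin n) → 𝕜) : Prop :=
  Integrable f volume ∧ ∃ lam a, IsAtomicDecomposition q f lam a

/-- The norm of `H^{1,q}_at`: the infimum of `∑ j, |lam j|` over all atomic decompositions. -/
def atomicHardyNorm {𝕜 : Type*} [RCLike 𝕜] {n : ℕ} (q : ℝ≥0∞)
    (f : EuclideanSpace ℝ (Fin n) → 𝕜) : ℝ≥0∞ :=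
  ⨅ (lam : ℕ → 𝕜) (a : ℕ → EuclideanSpace ℝ (Fin n) → 𝕜)
    (_ : IsAtomicDecomposition q f lam a), ∑' j, ‖lam j‖ₑ

/-- The coefficient `C' 2^m d^n`, where `d` is the distance of `x` to the complement of
`{M f > 2^m}`. -/
def coeff {𝕜 : Type*} [RCLike 𝕜] {n : ℕ} (A b : ℝ) (f : EuclideanSpace ℝ (Fin n) → 𝕜)
    (C' : ℝ) (m : ℤ) (x : EuclideanSpace ℝ (Fin n)) : ℝ :=
  C' * (2 : ℝ) ^ m * distCompl A b f m x ^ n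

end HardyAtomic

end

/-! This is a Calderón–Zygmund decomposition run at all dyadic heights at once. On each superlevel
set O^(m) take a Whitney partition of unity φ_j^(m), and let g_m equal f off O^(m) and Σ_j φ_j^(m) ·
(φ_j^(m)-average of f) on it (`smoothing`). Then |g_m| ≲ 2^m. Off O^(m) this is |f| ≲ Mf, which
comes from Lebesgue differentiation. On O^(m), a bump at distance d from the complement is a
multiple of a rescaled test function, and since b > 1 some w outside O^(m) lies within b·d of its
centre, so the average is ≲ Mf(w) ≤ 2^m. Hence g_m → 0 as m → -∞, g_m(y) = f(y) for large m wherever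
Mf(y) < ∞, and f = Σ_m (g_{m+1} - g_m).

To split g_{m+1} - g_m into local pieces with cancellation, smooth φ_j^(m) f at level m+1 and
subtract φ_j^(m) times the average of f (`piece`). Smoothing preserves integrals, so each piece has
mean zero (`integral_piece`). Because O^(m+1) ⊆ O^(m), a Whitney ball of level m+1 meeting supp
φ_j^(m) is not much larger than the Whitney ball of φ_j^(m). This keeps the support of the piece
local (`tsupport_piece_subset`) and makes φ_i^(m+1) φ_j^(m) a legitimate test function at the finer
scale, so the piece is still ≲ 2^m (`norm_piece_le_of_levelSet`).

Bounded overlap gives Σ |b_j^(m)(y)| ≲ Σ_{2^m < Mf(y)} 2^m ≲ Mf(y) (`tsum_enorm_piece_le`). This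
yields absolute pointwise convergence and also the majorant for dominated convergence in L^1, and in
L^p because Mf ∈ L^p when f ∈ L^p (`lintegral_grandMaximal_rpow_lt_top`). Disjointness of the
shrunken Whitney balls gives Σ 2^m d^n ≲ Σ 2^m |O^(m)| ≲ ‖Mf‖_1 (`tsum_coeff_le`). -/

noncomputable section

namespace HardyAtomic

variable {n : ℕ} {𝕜 : Type*} [RCLike 𝕜]

local notation "E" => EuclideanSpace ℝ (Fin n)

/-! ### Ball volumes, and testing against the grand maximal function. -/

/-- The volume of the unit ball of `ℝⁿ`. -/
def unitVol (n : ℕ) : ℝ := volume.real (Metric.ball (0 : EuclideanSpace ℝ (Fin n)) 1)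

theorem unitVol_pos : 0 < unitVol n :=
  ENNReal.toReal_pos (Metric.measure_ball_pos volume _ one_pos).ne' measure_ball_lt_top.ne

theorem volume_ball_eq (x : E) {r : ℝ} (hr : 0 < r) :
    volume (Metric.ball x r) = ENNReal.ofReal (unitVol n * r ^ n) := by
  rw [Measure.addHaar_ball_of_pos _ _ hr, finrank_euclideanSpace_fin, mul_comm (unitVol n),
    ENNReal.ofReal_mul (by positivity), unitVol, Measure.real,
    ENNReal.ofReal_toReal measure_ball_lt_top.ne]

theorem volume_closedBall_eq (x : E) {r : ℝ} (hr : 0 < r) :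
    volume (Metric.closedBall x r) = ENNReal.ofReal (unitVol n * r ^ n) := by
  rw [Measure.addHaar_closedBall _ _ hr.le, finrank_euclideanSpace_fin, mul_comm (unitVol n),
    ENNReal.ofReal_mul (by positivity), unitVol, Measure.real,
    ENNReal.ofReal_toReal measure_ball_lt_top.ne]

theorem volume_real_closedBall_eq (x : E) {r : ℝ} (hr : 0 < r) :
    volume.real (Metric.closedBall x r) = unitVol n * r ^ n := by
  have := unitVol_pos (n := n)
  rw [Measure.real, volume_closedBall_eq x hr, ENNReal.toReal_ofReal (by positivity)]

theorem convolution_mul_dilate_apply (f φ : E → 𝕜) (t : ℝ) (y : E) :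
    convolution f (dilate φ t) (ContinuousLinearMap.mul 𝕜 𝕜) volume y =
      ∫ z, f z * ((t ^ n)⁻¹ • φ (t⁻¹ • (y - z))) := by
  simp [convolution_def, dilate]

/-- Integrals of `f` against a smooth function at scale `t` are controlled by the grand maximal
function at all points of a neighbourhood of size `b t`. -/
theorem enorm_integral_smul_le_grandMaximal {A b : ℝ} (hA : 0 < A) (f : E → 𝕜) {ψ : E → ℝ}
    (hψ : ContDiff ℝ ∞ ψ) {y w : E} {t L : ℝ} (ht : 0 < t) (hL : 0 < L)
    (hsupp : tsupport ψ ⊆ Metric.ball y t) (hder : ∀ z, ‖fderiv ℝ ψ z‖ ≤ L)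
    (hw : dist y w < b * t) :
    ‖∫ z, ψ z • f z‖ₑ ≤ ENNReal.ofReal (L * t ^ (n + 1) / A) * grandMaximal A b f w := by
  -- The factor κ brings the gradient bound L·t of u ↦ ψ(y - t u) down to A. The reflection is
  -- needed because the convolution at y evaluates the dilate at y - z.
  set κ : ℝ := A / (L * t) with hκ
  have hκ0 : 0 < κ := by positivity
  let φ : E → 𝕜 := fun u => ((κ * ψ (y - t • u) : ℝ) : 𝕜)
  have hcont : ContDiff ℝ ∞ (fun u : E => κ * ψ (y - t • u)) :=
    contDiff_const.mul (hψ.comp (contDiff_const.sub (contDiff_id.const_smul t)))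
  have hφ : φ ∈ testClass 𝕜 n A := by
    refine ⟨(RCLike.ofRealCLM (K := 𝕜)).contDiff.comp hcont, ?_, fun u => ?_⟩
    · have hcl : IsClosed ((fun u : E => y - t • u) ⁻¹' tsupport ψ) :=
        (isClosed_tsupport ψ).preimage (by fun_prop)
      refine (closure_minimal (fun u hu => ?_) hcl).trans fun u hu => ?_
      · refine subset_tsupport _ fun h0 => hu ?_
        simp [φ, h0]
      · have := hsupp hu
        rw [Metric.mem_ball, dist_eq_norm, sub_sub_cancel_left, norm_neg, norm_smul,
          Real.norm_of_nonneg ht.le] at this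
        rw [mem_ball_zero_iff]
        nlinarith
    · have h1 : HasFDerivAt (fun u : E => y - t • u) (-(t • ContinuousLinearMap.id ℝ E)) u :=
        ((hasFDerivAt_id u).const_smul t).const_sub y
      have h2 : HasFDerivAt ψ (fderiv ℝ ψ (y - t • u)) (y - t • u) :=
        (hψ.differentiable (by simp)).differentiableAt.hasFDerivAt
      have h3 : HasFDerivAt φ _ u :=
        (RCLike.ofRealCLM (K := 𝕜)).hasFDerivAt.comp u ((h2.comp u h1).const_mul κ)
      rw [h3.fderiv]
      refine (ContinuousLinearMap.opNorm_comp_le _ _).trans ?_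
      rw [RCLike.ofRealCLM_norm, one_mul, norm_smul, Real.norm_of_nonneg hκ0.le]
      have h4 : ‖(fderiv ℝ ψ (y - t • u)).comp (-(t • ContinuousLinearMap.id ℝ E))‖ ≤ L * t := by
        refine (ContinuousLinearMap.opNorm_comp_le _ _).trans ?_
        gcongr
        · exact hder _
        · rw [norm_neg, norm_smul, Real.norm_of_nonneg ht.le]
          exact mul_le_of_le_one_right ht.le ContinuousLinearMap.norm_id_le
      calc κ * _ ≤ κ * (L * t) := by gcongr
        _ = A := by rw [hκ]; field_simp
  have hconv : convolution f (dilate φ t) (ContinuousLinearMap.mul 𝕜 𝕜) volume y =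
      ((t ^ n)⁻¹ * κ) • ∫ z, ψ z • f z := by
    rw [convolution_mul_dilate_apply, ← integral_smul]
    congr 1 with z
    simp only [φ, smul_inv_smul₀ ht.ne', sub_sub_cancel]
    simp only [RCLike.real_smul_eq_coe_mul, RCLike.ofReal_mul]
    ring
  have hle : ‖convolution f (dilate φ t) (ContinuousLinearMap.mul 𝕜 𝕜) volume y‖ₑ ≤
      grandMaximal A b f w := by
    unfold grandMaximal
    exact le_iSup_of_le φ <| le_iSup_of_le hφ <| le_iSup_of_le t <| le_iSup_of_le ht <|
      le_iSup_of_le y <| le_iSup_of_le hw le_rfl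
  have hcoef : ENNReal.ofReal (L * t ^ (n + 1) / A) * ENNReal.ofReal ((t ^ n)⁻¹ * κ) = 1 := by
    rw [← ENNReal.ofReal_mul (by positivity), ← ENNReal.ofReal_one]
    congr 1
    rw [hκ]
    field_simp
    ring
  calc ‖∫ z, ψ z • f z‖ₑ
      = ENNReal.ofReal (L * t ^ (n + 1) / A) *
          ‖convolution f (dilate φ t) (ContinuousLinearMap.mul 𝕜 𝕜) volume y‖ₑ := by
        rw [hconv, enorm_smul, Real.enorm_eq_ofReal (by positivity), ← mul_assoc, hcoef, one_mul]
    _ ≤ _ := by gcongr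

-- All `ContDiffBump`s with ratio `rOut / rIn = 2` are translates and dilates of a single one, so
-- one gradient bound rescales to all of them.
variable (n) in
theorem exists_bump_fderiv_bound :
    ∃ K : ℝ, 0 < K ∧ ∀ (c : E) (φ : ContDiffBump c),
      φ.rOut = 2 * φ.rIn → ∀ z, ‖fderiv ℝ φ z‖ ≤ K / φ.rIn := by
  let φ₀ : ContDiffBump (0 : E) := ⟨1, 2, one_pos, one_lt_two⟩
  have hc : Continuous (fderiv ℝ φ₀) := φ₀.contDiff.continuous_fderiv (n := 1) (by simp)
  obtain ⟨K, hK⟩ := hc.bounded_above_of_compact_support (φ₀.hasCompactSupport.fderiv (𝕜 := ℝ))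
  refine ⟨max K 1, by positivity, fun c φ hφ z => ?_⟩
  have hr := φ.rIn_pos
  have heq : (φ : E → ℝ) = φ₀ ∘ fun z => φ.rIn⁻¹ • (z - c) := by
    ext z
    rw [Function.comp_apply]
    have h2 : φ.rOut / φ.rIn = 2 := by rw [hφ]; field_simp
    rw [φ.apply, φ₀.apply, h2]
    simp [φ₀]
  have h1 : HasFDerivAt (fun z : E => φ.rIn⁻¹ • (z - c))
      (φ.rIn⁻¹ • ContinuousLinearMap.id ℝ E) z :=
    ((hasFDerivAt_id z).sub_const c).const_smul φ.rIn⁻¹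
  have h2 : HasFDerivAt φ₀ (fderiv ℝ φ₀ (φ.rIn⁻¹ • (z - c))) (φ.rIn⁻¹ • (z - c)) :=
    ((φ₀.contDiff (n := 1)).differentiable (by simp)).differentiableAt.hasFDerivAt
  have h3 := HasFDerivAt.comp (g := φ₀) z h2 h1
  rw [heq, h3.fderiv]
  refine (ContinuousLinearMap.opNorm_comp_le _ _).trans ?_
  rw [div_eq_mul_inv]
  gcongr
  · exact (hK _).trans (le_max_left _ _)
  · rw [norm_smul, norm_inv, Real.norm_of_nonneg hr.le]
    exact mul_le_of_le_one_right (by positivity) ContinuousLinearMap.norm_id_le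

variable (n) (𝕜) in
/-- `f` is pointwise dominated by its grand maximal function. -/
theorem exists_enorm_le_grandMaximal {A b : ℝ} (hA : 0 < A) (hb : 1 < b) :
    ∃ C : ℝ, 0 < C ∧ ∀ f : E → 𝕜, LocallyIntegrable f volume →
      (∀ᵐ x, ‖f x‖ₑ ≤ ENNReal.ofReal C * grandMaximal A b f x) ∧
      (Continuous f → ∀ x, ‖f x‖ₑ ≤ ENNReal.ofReal C * grandMaximal A b f x) := by
  obtain ⟨K, hK, hbump⟩ := exists_bump_fderiv_bound n
  have hv := unitVol_pos (n := n)
  let φ : ℕ → ContDiffBump (0 : E) := fun k =>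
    ⟨1 / ((k : ℝ) + 1), 2 * (1 / ((k : ℝ) + 1)), by positivity, by
      have : (0 : ℝ) < 1 / ((k : ℝ) + 1) := by positivity
      linarith⟩
  have hφ : Tendsto (fun k => (φ k).rOut) atTop (𝓝 0) := by
    simpa [φ] using (tendsto_one_div_add_atTop_nhds_zero_nat (𝕜 := ℝ)).const_mul 2
  -- This is L·t^(n+1)/A with t = 3r and L = (K/r)/(unitVol·r^n), the gradient bound of a normalized
  -- bump of inner radius r. The powers of r cancel, so C is the same for the whole approximate
  -- identity. The radius 3r leaves room for the closed support of radius 2r.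
  set C : ℝ := K * 3 ^ (n + 1) / (unitVol n * A) with hC
  have key : ∀ (f : E → 𝕜) (x : E), Tendsto (fun k => (convolution ((φ k).normed volume) f
      (ContinuousLinearMap.lsmul ℝ ℝ) volume) x) atTop (𝓝 (f x)) →
      ‖f x‖ₑ ≤ ENNReal.ofReal C * grandMaximal A b f x := by
    intro f x hlim
    refine le_of_tendsto hlim.enorm (Eventually.of_forall fun k => ?_)
    set r := (φ k).rIn with hr
    have hr0 : 0 < r := (φ k).rIn_pos
    have hout : (φ k).rOut = 2 * r := rfl
    have hI : unitVol n * r ^ n ≤ ∫ z, φ k z := by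
      rw [← volume_real_closedBall_eq (0 : E) hr0]
      exact (φ k).measure_closedBall_le_integral volume
    have hI0 : 0 < ∫ z, φ k z := (φ k).integral_pos
    have hsm : ContDiff ℝ ∞ (fun z : E => (φ k).normed volume (x - z)) :=
      (φ k).contDiff_normed.comp (contDiff_const.sub contDiff_id)
    have hL : 0 < K / r / (unitVol n * r ^ n) := by positivity
    have hsupp : tsupport (fun z : E => (φ k).normed volume (x - z)) ⊆ Metric.ball x (3 * r) := by
      refine (closure_minimal (t := Metric.closedBall x (2 * r)) (fun z hz => ?_)
        Metric.isClosed_closedBall).trans (Metric.closedBall_subset_ball (by linarith))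
      have : x - z ∈ Function.support ((φ k).normed volume) := hz
      rw [(φ k).support_normed_eq, hout, mem_ball_zero_iff] at this
      rw [Metric.mem_closedBall, dist_comm, dist_eq_norm]
      exact this.le
    have hder : ∀ z, ‖fderiv ℝ (fun z : E => (φ k).normed volume (x - z)) z‖ ≤
        K / r / (unitVol n * r ^ n) := by
      intro z
      have h1 : HasFDerivAt (fun z : E => x - z) (-(ContinuousLinearMap.id ℝ E)) z :=
        (hasFDerivAt_id z).const_sub x
      have h2 : HasFDerivAt (φ k) (fderiv ℝ (φ k) (x - z)) (x - z) :=
        (((φ k).contDiff (n := 1)).differentiable (by simp)).differentiableAt.hasFDerivAt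
      have h3 : HasFDerivAt (fun z : E => (φ k).normed volume (x - z)) _ z :=
        (h2.comp z h1).mul_const (∫ z, φ k z)⁻¹
      rw [h3.fderiv, norm_smul, norm_inv, Real.norm_of_nonneg hI0.le, ← div_eq_inv_mul]
      gcongr
      rw [ContinuousLinearMap.comp_neg, norm_neg, ContinuousLinearMap.comp_id]
      exact hbump 0 (φ k) hout _
    have := enorm_integral_smul_le_grandMaximal (b := b) hA f hsm (y := x) (w := x) (t := 3 * r)
      (by positivity) hL hsupp hder (by rw [dist_self]; positivity)
    rw [convolution_eq_swap]
    refine this.trans (le_of_eq ?_)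
    congr 2
    rw [hC]
    field_simp
    ring
  refine ⟨C, by positivity, fun f hf => ⟨?_, fun hc x => ?_⟩⟩
  · filter_upwards [ContDiffBump.ae_convolution_tendsto_right_of_locallyIntegrable (K := 2) hφ
      (Eventually.of_forall fun k => le_rfl) hf] with x hx
    exact key f x hx
  · exact key f x (ContDiffBump.convolution_tendsto_right_of_continuous hφ hc x)

/-! ### Superlevel sets of the grand maximal function and dyadic sums. -/

theorem grandMaximal_congr_ae {A b : ℝ} {f g : E → 𝕜} (h : f =ᵐ[volume] g) :
    grandMaximal A b f = grandMaximal A b g := by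
  have : ∀ φ : E → 𝕜, ∀ y, convolution f φ (ContinuousLinearMap.mul 𝕜 𝕜) volume y =
      convolution g φ (ContinuousLinearMap.mul 𝕜 𝕜) volume y := by
    intro φ y
    simp only [convolution_def]
    refine integral_congr_ae ?_
    filter_upwards [h] with z hz
    rw [hz]
  funext x
  simp only [grandMaximal, this]

/-- The base point x enters only through the strict inequality |y - x| < b t, so a triple (φ, t, y)
that witnesses a large value at x does so near x as well. -/
theorem isOpen_lt_grandMaximal {A b : ℝ} (f : E → 𝕜) (s : ℝ≥0∞) :
    IsOpen {x | s < grandMaximal A b f x} := by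
  rw [isOpen_iff_mem_nhds]
  intro x hx
  simp only [Set.mem_ofPred_eq, grandMaximal, lt_iSup_iff] at hx
  obtain ⟨φ, hφ, t, ht, y, hy, hlt⟩ := hx
  have : {x' : E | dist y x' < b * t} ∈ 𝓝 x :=
    (isOpen_lt (by fun_prop) continuous_const).mem_nhds hy
  filter_upwards [this] with x' hx'
  simp only [grandMaximal, lt_iSup_iff]
  exact ⟨φ, hφ, t, ht, y, hx', hlt⟩

theorem isOpen_levelSet {A b : ℝ} (f : E → 𝕜) (m : ℤ) : IsOpen (levelSet A b f m) :=
  isOpen_lt_grandMaximal f _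

theorem measurable_grandMaximal {A b : ℝ} (f : E → 𝕜) : Measurable (grandMaximal A b f) :=
  measurable_of_Ioi fun s => (isOpen_lt_grandMaximal f s).measurableSet

theorem levelSet_antitone {A b : ℝ} (f : E → 𝕜) : Antitone (levelSet A b f) := by
  intro m m' h x hx
  exact lt_of_le_of_lt (ENNReal.zpow_le_of_le (by norm_num) h) hx

/-- By Chebyshev, a superlevel set filling the space would give it finite measure, which fails for n
≥ 1. A point of the complement is needed to make `infDist` a true distance instead of its default
value 0. -/
theorem compl_levelSet_nonempty (hn : 1 ≤ n) {A b : ℝ} {f : E → 𝕜}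
    (hf : hardyNorm A b f < ⊤) (m : ℤ) : (levelSet A b f m)ᶜ.Nonempty := by
  rw [Set.nonempty_compl]
  intro h
  have : Nonempty (Fin n) := ⟨⟨0, hn⟩⟩
  have h2 : (2 : ℝ≥0∞) ^ m ≠ 0 := (ENNReal.zpow_pos (by simp) (by simp) m).ne'
  have h1 : (2 : ℝ≥0∞) ^ m * volume (Set.univ : Set E) ≤ hardyNorm A b f := by
    rw [← setLIntegral_const, setLIntegral_univ]
    refine lintegral_mono fun x => ?_
    have : x ∈ levelSet A b f m := h ▸ Set.mem_univ x
    exact this.le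
  rw [measure_univ_of_isAddLeftInvariant, ENNReal.mul_top h2] at h1
  exact absurd hf (not_lt.mpr h1)

/-- Dyadic summation: `∑_{2^m < a} 2^{mq}` is comparable to `a^q`. -/
theorem exists_tsum_zpow_lt_le {q : ℝ} (hq : 0 < q) :
    ∃ C : ℝ≥0∞, C ≠ 0 ∧ C ≠ ⊤ ∧ ∀ a : ℝ≥0∞,
      ∑' m : ℤ, (if (2 : ℝ≥0∞) ^ m < a then ((2 : ℝ≥0∞) ^ m) ^ q else 0) ≤ C * a ^ q := by
  set ρ : ℝ≥0∞ := ((2 : ℝ≥0∞) ^ q)⁻¹ with hρ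
  have hρ1 : ρ < 1 := by
    rw [hρ, ENNReal.inv_lt_one]
    exact ENNReal.one_lt_rpow (by norm_num) hq
  refine ⟨(1 - ρ)⁻¹, by simp, by simpa [tsub_eq_zero_iff_le] using hρ1, fun a => ?_⟩
  rcases eq_or_ne a 0 with rfl | ha0
  · simp
  rcases eq_or_ne a ⊤ with rfl | hat
  · rw [ENNReal.top_rpow_of_pos hq, ENNReal.mul_top (by simp)]
    exact le_top
  -- M is the last index that contributes. Counting down from it, m = M - k, turns the sum into a
  -- geometric series of ratio 2^(-q).
  obtain ⟨M, hM1, hM2⟩ := ENNReal.exists_mem_Ioc_zpow ha0 hat (y := 2) (by norm_num) (by simp)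
  have hinj : Function.Injective (fun k : ℕ => M - (k : ℤ)) := fun k l h => by
    simpa using h
  have hsupp : Function.support
      (fun m : ℤ => if (2 : ℝ≥0∞) ^ m < a then ((2 : ℝ≥0∞) ^ m) ^ q else 0) ⊆
      Set.range (fun k : ℕ => M - (k : ℤ)) := by
    intro m hm
    have h1 : (2 : ℝ≥0∞) ^ m < a := by
      by_contra h
      exact hm (by simp [h])
    have h2 : m ≤ M := by
      by_contra! h
      exact absurd (h1.trans_le hM2) (not_lt.mpr (ENNReal.zpow_le_of_le (by norm_num) h))
    exact ⟨(M - m).toNat, by simp only; omega⟩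
  rw [← hinj.tsum_eq hsupp]
  calc _ ≤ ∑' k : ℕ, a ^ q * ρ ^ k := by
        refine ENNReal.tsum_le_tsum fun k => ?_
        split_ifs with h
        · have : ((2 : ℝ≥0∞) ^ (M - (k : ℤ))) ^ q = ((2 : ℝ≥0∞) ^ M) ^ q * ρ ^ k := by
            rw [ENNReal.zpow_sub (by simp) (by simp), ENNReal.mul_rpow_of_nonneg _ _ hq.le, hρ,
              ENNReal.inv_rpow, ← ENNReal.inv_pow, zpow_natCast, ← ENNReal.rpow_natCast,
              ← ENNReal.rpow_natCast, ← ENNReal.rpow_mul, ← ENNReal.rpow_mul, mul_comm q]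
          rw [this]
          gcongr
        · positivity
    _ = (1 - ρ)⁻¹ * a ^ q := by rw [ENNReal.tsum_mul_left, ENNReal.tsum_geometric, mul_comm]

/-! ### Whitney coverings and partitions of unity. -/

theorem infDist_compl_pos {O : Set E} (hO : IsOpen O) (hne : Oᶜ.Nonempty) {x : E} (hx : x ∈ O) :
    0 < Metric.infDist x Oᶜ :=
  (hO.isClosed_compl.notMem_iff_infDist_pos hne).1 (Set.notMem_compl_iff.mpr hx)

theorem mem_of_infDist_compl_pos {O : Set E} {x : E} (hx : 0 < Metric.infDist x Oᶜ) : x ∈ O := by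
  by_contra h
  exact hx.ne' (Metric.infDist_zero_of_mem h)

/-- Whitney covering: a maximal family of disjoint balls whose radii are proportional to the
distance to the complement. -/
theorem exists_whitney_centers {O : Set E} (hO : IsOpen O) (hne : Oᶜ.Nonempty) :
    ∃ (J : Set ℕ) (x : ℕ → E), (∀ j ∈ J, x j ∈ O) ∧
      J.PairwiseDisjoint (fun j => Metric.ball (x j) (Metric.infDist (x j) Oᶜ / 128)) ∧
      ∀ y ∈ O, ∃ j ∈ J, dist y (x j) ≤ 3 / 128 * Metric.infDist (x j) Oᶜ := by
  set B : E → Set E := fun x => Metric.ball x (Metric.infDist x Oᶜ / 128) with hB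
  have hpos : ∀ x ∈ O, 0 < Metric.infDist x Oᶜ := fun x hx => infDist_compl_pos hO hne hx
  obtain ⟨S, hS⟩ := zorn_subset {S : Set E | S ⊆ O ∧ S.PairwiseDisjoint B} fun c hc hch =>
    ⟨⋃₀ c, ⟨Set.sUnion_subset fun s hs => (hc hs).1,
      (Set.pairwiseDisjoint_sUnion hch.directedOn).2 fun s hs => (hc hs).2⟩,
      fun s hs => Set.subset_sUnion_of_mem hs⟩
  obtain ⟨hSO, hSd⟩ := hS.prop
  have hcover : ∀ y ∈ O, ∃ x ∈ S, dist y x ≤ 3 / 128 * Metric.infDist x Oᶜ := by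
    intro y hy
    have : ∃ x ∈ S, (B y ∩ B x).Nonempty := by
      by_contra! h
      have hins : insert y S ⊆ O ∧ (insert y S).PairwiseDisjoint B :=
        ⟨Set.insert_subset hy hSO, hSd.insert fun x hx _ =>
          Set.disjoint_iff_inter_eq_empty.mpr (h x hx)⟩
      have hyS : y ∈ S := hS.le_of_ge hins (Set.subset_insert y S) (Set.mem_insert y S)
      have h1 := h y hyS
      rw [Set.inter_self, hB] at h1
      exact (Metric.nonempty_ball.mpr (by linarith [hpos y hy])).ne_empty h1
    -- With d the distance to the complement, |y - x| < (d(y) + d(x))/128 and d(y) ≤ d(x) + |y - x|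
    -- give |y - x| < (2/127) d(x), which is below (3/128) d(x).
    obtain ⟨x, hx, z, hzy, hzx⟩ := this
    refine ⟨x, hx, ?_⟩
    rw [hB, Metric.mem_ball] at hzy hzx
    have h1 := dist_triangle_left y x z
    have h2 : Metric.infDist y Oᶜ ≤ Metric.infDist x Oᶜ + dist y x :=
      Metric.infDist_le_infDist_add_dist
    have := hpos x (hSO hx)
    linarith
  have hcount : S.Countable := hSd.countable_of_isOpen (fun _ _ => Metric.isOpen_ball)
    fun x hx => Metric.nonempty_ball.mpr (by linarith [hpos x (hSO hx)])
  obtain ⟨e, he⟩ := Set.countable_iff_exists_injOn.mp hcount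
  have hinv : ∀ x ∈ S, Function.invFunOn e S (e x) = x := fun x hx => he.leftInvOn_invFunOn hx
  refine ⟨e '' S, Function.invFunOn e S, ?_, ?_, ?_⟩
  · rintro _ ⟨x, hx, rfl⟩
    rw [hinv x hx]
    exact hSO hx
  · rintro _ ⟨x, hx, rfl⟩ _ ⟨y, hy, rfl⟩ hxy
    simp only [Function.onFun, hinv x hx, hinv y hy]
    exact hSd hx hy fun h => hxy (h ▸ rfl)
  · intro y hy
    obtain ⟨x, hx, h⟩ := hcover y hy
    exact ⟨e x, ⟨x, hx, rfl⟩, by rwa [hinv x hx]⟩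

/-- The Whitney balls have the bounded intersection property. -/
theorem encard_whitney_le {O : Set E} {J : Set ℕ} {x : ℕ → E}
    (hdisj : J.PairwiseDisjoint (fun j => Metric.ball (x j) (Metric.infDist (x j) Oᶜ / 128)))
    (y : E) :
    {j | j ∈ J ∧ y ∈ Metric.ball (x j) (1 / 2 * Metric.infDist (x j) Oᶜ)}.encard ≤
      (1024 ^ n : ℕ) := by
  set S := {j | j ∈ J ∧ y ∈ Metric.ball (x j) (1 / 2 * Metric.infDist (x j) Oᶜ)} with hS
  rcases S.eq_empty_or_nonempty with h | ⟨i, hi⟩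
  · rw [h]; simp
  have hdist : ∀ j ∈ S, Metric.infDist (x j) Oᶜ ≤ 2 * Metric.infDist y Oᶜ ∧
      Metric.infDist y Oᶜ ≤ 2 * Metric.infDist (x j) Oᶜ ∧
      dist y (x j) < 1 / 2 * Metric.infDist (x j) Oᶜ := by
    intro j hj
    have h0 : dist y (x j) < 1 / 2 * Metric.infDist (x j) Oᶜ := hj.2
    have h1 : Metric.infDist y Oᶜ ≤ Metric.infDist (x j) Oᶜ + dist y (x j) :=
      Metric.infDist_le_infDist_add_dist
    have h2 : Metric.infDist (x j) Oᶜ ≤ Metric.infDist y Oᶜ + dist (x j) y :=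
      Metric.infDist_le_infDist_add_dist
    rw [dist_comm] at h2
    have := dist_nonneg (x := y) (y := x j)
    exact ⟨by linarith, by linarith, h0⟩
  set D := Metric.infDist y Oᶜ with hD
  have hD0 : 0 < D := by
    have := hdist i hi
    have := dist_nonneg (x := y) (y := x i)
    linarith
  have hv := unitVol_pos (n := n)
  set V := ENNReal.ofReal (unitVol n * (D / 256) ^ n) with hV
  have hV0 : V ≠ 0 := by
    rw [hV, Ne, ENNReal.ofReal_eq_zero, not_le]
    positivity
  -- A volume count: every ball in question has d(x_j) between D/2 and 2D, so its shrunken ball has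
  -- radius at least D/256 and lies in B(y, 4D), and 4·256 = 1024.
  have hbig : volume (Metric.ball y (4 * D)) = (1024 ^ n : ℕ) * V := by
    rw [volume_ball_eq y (by positivity), hV, ← ENNReal.ofReal_natCast,
      ← ENNReal.ofReal_mul (by positivity)]
    congr 1
    push_cast
    rw [mul_left_comm, ← mul_pow]
    congr 2
    ring
  have hsum : (S.encard : ℝ≥0∞) * V ≤ (1024 ^ n : ℕ) * V := by
    rw [← ENNReal.tsum_set_const, ← hbig]
    calc ∑' _ : S, V ≤ ∑' j : S, volume (Metric.ball (x j) (Metric.infDist (x j) Oᶜ / 128)) := by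
          refine ENNReal.tsum_le_tsum fun j => ?_
          have := hdist j j.2
          rw [volume_ball_eq _ (by linarith)]
          exact ENNReal.ofReal_le_ofReal (mul_le_mul_of_nonneg_left
            (pow_le_pow_left₀ (by positivity) (by linarith) n) hv.le)
      _ = volume (⋃ j : S, Metric.ball (x j) (Metric.infDist (x j) Oᶜ / 128)) := by
          rw [measure_iUnion _ fun _ => measurableSet_ball]
          exact (hdisj.subset fun j hj => hj.1).subtype _ _
      _ ≤ volume (Metric.ball y (4 * D)) := by
          refine measure_mono (Set.iUnion_subset fun j => Metric.ball_subset_ball' ?_)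
          have := hdist j j.2
          rw [dist_comm]
          linarith
  have := (ENNReal.mul_le_mul_iff_left hV0 ENNReal.ofReal_ne_top).mp hsum
  rw [← ENat.toENNReal_le]
  simpa using this

/-- A smooth partition of unity subordinate to a Whitney covering of the open set `O`, with
gradient bounds `K / d` and masses at least `c * d ^ n`, where `d` is the distance of the centers
to the complement of `O`. -/
structure WhitneyPartition (K c : ℝ) (O : Set E) where
  index : Set ℕ
  center : ℕ → E
  bump : ℕ → E → ℝ
  center_mem : ∀ j ∈ index, center j ∈ O
  bump_eq_zero : ∀ j ∉ index, bump j = 0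
  contDiff : ∀ j, ContDiff ℝ ∞ (bump j)
  nonneg : ∀ j y, 0 ≤ bump j y
  tsupport_subset : ∀ j ∈ index,
    tsupport (bump j) ⊆ Metric.closedBall (center j) (Metric.infDist (center j) Oᶜ / 16)
  norm_fderiv_le : ∀ j ∈ index, ∀ y, ‖fderiv ℝ (bump j) y‖ ≤ K / Metric.infDist (center j) Oᶜ
  le_integral : ∀ j ∈ index, c * Metric.infDist (center j) Oᶜ ^ n ≤ ∫ y, bump j y
  hasSum_one : ∀ y ∈ O, HasSum (fun j => bump j y) 1
  pairwiseDisjoint : index.PairwiseDisjoint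
    (fun j => Metric.ball (center j) (Metric.infDist (center j) Oᶜ / 128))

/-- Neighbourhoods of points of `O` meet finitely many Whitney balls, all of comparable size. -/
theorem exists_finset_whitney {O : Set E} (hO : IsOpen O) (hne : Oᶜ.Nonempty) {J : Set ℕ}
    {x : ℕ → E}
    (hdisj : J.PairwiseDisjoint (fun j => Metric.ball (x j) (Metric.infDist (x j) Oᶜ / 128)))
    {y : E} (hy : y ∈ O) :
    ∃ T : Finset ℕ, T.card ≤ 1024 ^ n ∧ (∀ j ∈ T, j ∈ J ∧
        Metric.infDist y Oᶜ ≤ 3 / 2 * Metric.infDist (x j) Oᶜ) ∧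
      ∀ z ∈ Metric.ball y (Metric.infDist y Oᶜ / 8), ∀ j ∈ J, j ∉ T →
        z ∉ Metric.closedBall (x j) (Metric.infDist (x j) Oᶜ / 16) := by
  -- T collects the j with y ∈ B(x_j, d_j/2). If z is within D/8 of y and within d_j/16 of x_j, then
  -- D ≤ d_j + |y - x_j| forces |y - x_j| < (3/14) d_j, so j is already in T.
  have henc := encard_whitney_le hdisj y
  have hfin := Set.finite_of_encard_le_coe henc
  have hD := infDist_compl_pos hO hne hy
  refine ⟨hfin.toFinset, ?_, fun j hj => ?_, fun z hz j hj hjT hzj => hjT ?_⟩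
  · rw [hfin.encard_eq_coe_toFinset_card] at henc
    exact_mod_cast henc
  · obtain ⟨h1, h2⟩ := (Set.Finite.mem_toFinset _).mp hj
    refine ⟨h1, ?_⟩
    have h3 : Metric.infDist y Oᶜ ≤ Metric.infDist (x j) Oᶜ + dist y (x j) :=
      Metric.infDist_le_infDist_add_dist
    rw [Metric.mem_ball] at h2
    linarith
  · refine (Set.Finite.mem_toFinset _).mpr ⟨hj, ?_⟩
    have h3 : Metric.infDist y Oᶜ ≤ Metric.infDist (x j) Oᶜ + dist y (x j) :=
      Metric.infDist_le_infDist_add_dist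
    have h4 := dist_triangle_left y (x j) z
    rw [Metric.mem_ball] at hz ⊢
    rw [Metric.mem_closedBall] at hzj
    have := dist_nonneg (x := y) (y := x j)
    linarith

-- Bumps equal to 1 on balls of radius d/32 ≥ 3d/128 and supported at radius d/16 are divided by
-- their sum S. The covering gives S ≥ 1 and bounded overlap gives S ≤ N, so S costs only constants
-- in the gradient and mass bounds.
variable (n) in
theorem exists_whitneyPartition :
    ∃ K c : ℝ, 0 < K ∧ 0 < c ∧ ∀ O : Set E, IsOpen O → Oᶜ.Nonempty →
      Nonempty (WhitneyPartition K c O) := by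
  obtain ⟨K₀, hK₀, hbump⟩ := exists_bump_fderiv_bound n
  have hv := unitVol_pos (n := n)
  set N : ℝ := 1024 ^ n with hN
  have hN0 : 0 < N := by positivity
  refine ⟨K₀ * 32 + N * (K₀ * 64), unitVol n / (N * 32 ^ n), by positivity, by positivity,
    fun O hO hne => ?_⟩
  obtain ⟨J, x, hxO, hdisj, hcover⟩ := exists_whitney_centers hO hne
  classical
  set d : ℕ → ℝ := fun j => Metric.infDist (x j) Oᶜ with hd
  have hd0 : ∀ j ∈ J, 0 < d j := fun j hj => infDist_compl_pos hO hne (hxO j hj)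
  let φ : ∀ j ∈ J, ContDiffBump (x j) := fun j hj =>
    ⟨d j / 32, d j / 16, by linarith [hd0 j hj], by linarith [hd0 j hj]⟩
  let η : ℕ → E → ℝ := fun j => if hj : j ∈ J then φ j hj else 0
  have hηJ : ∀ j (hj : j ∈ J), η j = φ j hj := fun j hj => dif_pos hj
  have hηJc : ∀ j ∉ J, η j = 0 := fun j hj => dif_neg hj
  have hη0 : ∀ j y, 0 ≤ η j y := by
    intro j y
    by_cases hj : j ∈ J
    · rw [hηJ j hj]; exact (φ j hj).nonneg
    · rw [hηJc j hj]; exact le_rfl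
  have hη1 : ∀ j y, η j y ≤ 1 := by
    intro j y
    by_cases hj : j ∈ J
    · rw [hηJ j hj]; exact (φ j hj).le_one
    · rw [hηJc j hj]; exact zero_le_one
  have hηsm : ∀ j, ContDiff ℝ ∞ (η j) := by
    intro j
    by_cases hj : j ∈ J
    · rw [hηJ j hj]; exact (φ j hj).contDiff
    · rw [hηJc j hj]; exact contDiff_const
  have hηts : ∀ j ∈ J, tsupport (η j) = Metric.closedBall (x j) (d j / 16) := by
    intro j hj
    rw [hηJ j hj]; exact (φ j hj).tsupport_eq
  have hηO : ∀ j, tsupport (η j) ⊆ O := by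
    intro j
    by_cases hj : j ∈ J
    · intro y hy
      rw [hηts j hj, Metric.mem_closedBall] at hy
      apply mem_of_infDist_compl_pos
      have h1 : d j ≤ Metric.infDist y Oᶜ + dist (x j) y := Metric.infDist_le_infDist_add_dist
      rw [dist_comm] at h1
      linarith [hd0 j hj]
    · rw [hηJc j hj]; simp
  have hηd : ∀ j ∈ J, ∀ z, ‖fderiv ℝ (η j) z‖ ≤ K₀ * 32 / d j := by
    intro j hj z
    rw [hηJ j hj]
    refine (hbump (x j) (φ j hj) ?_ z).trans (le_of_eq ?_)
    · change d j / 16 = 2 * (d j / 32); ring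
    · change K₀ / (d j / 32) = _
      rw [div_div_eq_mul_div]
  set S : E → ℝ := fun y => ∑' j, η j y with hS
  have hloc : ∀ y ∈ O, ∃ T : Finset ℕ, T.card ≤ 1024 ^ n ∧ (∀ j ∈ T, j ∈ J ∧
      Metric.infDist y Oᶜ ≤ 3 / 2 * d j) ∧ (∀ j ∉ T, η j y = 0) ∧
      S =ᶠ[𝓝 y] fun z => ∑ j ∈ T, η j z := by
    intro y hy
    obtain ⟨T, hT1, hT2, hT3⟩ := exists_finset_whitney hO hne hdisj hy
    have hD := infDist_compl_pos hO hne hy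
    have hzero : ∀ z ∈ Metric.ball y (Metric.infDist y Oᶜ / 8), ∀ j ∉ T, η j z = 0 := by
      intro z hz j hjT
      by_cases hj : j ∈ J
      · refine image_eq_zero_of_notMem_tsupport ?_
        rw [hηts j hj]
        exact hT3 z hz j hj hjT
      · rw [hηJc j hj]; rfl
    refine ⟨T, hT1, hT2, hzero y (Metric.mem_ball_self (by positivity)), ?_⟩
    filter_upwards [Metric.ball_mem_nhds y (show 0 < Metric.infDist y Oᶜ / 8 by positivity)]
      with z hz
    exact tsum_eq_sum fun j hj => hzero z hz j hj
  have hsummable : ∀ y ∈ O, Summable fun j => η j y := by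
    intro y hy
    obtain ⟨T, _, _, hT, _⟩ := hloc y hy
    exact summable_of_ne_finset_zero fun j hj => hT j hj
  have hS1 : ∀ y ∈ O, 1 ≤ S y := by
    intro y hy
    obtain ⟨j, hj, hjy⟩ := hcover y hy
    have : η j y = 1 := by
      rw [hηJ j hj]
      refine (φ j hj).one_of_mem_closedBall ?_
      rw [Metric.mem_closedBall]
      change _ ≤ d j / 32
      have := hd0 j hj
      simp only [hd] at this ⊢
      linarith
    rw [← this]
    exact (hsummable y hy).le_tsum j fun i _ => hη0 i y
  have hSN : ∀ y ∈ O, S y ≤ N := by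
    intro y hy
    obtain ⟨T, hT, _, _, heq⟩ := hloc y hy
    rw [heq.eq_of_nhds]
    calc ∑ j ∈ T, η j y ≤ ∑ j ∈ T, (1 : ℝ) := Finset.sum_le_sum fun j _ => hη1 j y
      _ = T.card := by simp
      _ ≤ N := by rw [hN]; exact_mod_cast hT
  have hSsm : ∀ y ∈ O, ContDiffAt ℝ ∞ S y := by
    intro y hy
    obtain ⟨T, _, _, _, heq⟩ := hloc y hy
    exact (ContDiffAt.sum fun j _ => (hηsm j).contDiffAt).congr_of_eventuallyEq heq
  -- On supp η_j the distance to the complement is at least (15/16) d_j, while each bump i in T has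
  -- d_i at least 2/3 of that distance. So d_i ≥ (5/8) d_j, and 32/d_i ≤ 64/d_j.
  have hSd : ∀ j ∈ J, ∀ y ∈ tsupport (η j), ‖fderiv ℝ S y‖ ≤ N * (K₀ * 64 / d j) := by
    intro j hj y hy
    obtain ⟨T, hT1, hT2, _, heq⟩ := hloc y (hηO j hy)
    rw [heq.fderiv_eq, fderiv_fun_sum fun i _ =>
      ((hηsm i).differentiable (by simp)).differentiableAt]
    refine (norm_sum_le _ _).trans ?_
    have hle : ∀ i ∈ T, ‖fderiv ℝ (η i) y‖ ≤ K₀ * 64 / d j := by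
      intro i hi
      obtain ⟨hiJ, hi2⟩ := hT2 i hi
      have hi0 := hd0 i hiJ
      have hj0 := hd0 j hj
      refine (hηd i hiJ y).trans ?_
      rw [hηts j hj, Metric.mem_closedBall] at hy
      have h1 : d j ≤ Metric.infDist y Oᶜ + dist (x j) y := Metric.infDist_le_infDist_add_dist
      rw [dist_comm] at h1
      rw [div_le_div_iff₀ hi0 hj0]
      nlinarith
    calc ∑ i ∈ T, ‖fderiv ℝ (η i) y‖ ≤ ∑ i ∈ T, K₀ * 64 / d j := Finset.sum_le_sum hle
      _ = T.card * (K₀ * 64 / d j) := by simp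
      _ ≤ N * (K₀ * 64 / d j) := by
        have := hd0 j hj
        gcongr
        rw [hN]; exact_mod_cast hT1
  have hψts : ∀ j, tsupport (fun y => η j y / S y) ⊆ tsupport (η j) := fun j =>
    closure_mono fun y hy h => hy (by simp [h])
  have hψsm : ∀ j, ContDiff ℝ ∞ (fun y => η j y / S y) := by
    intro j
    refine contDiff_iff_contDiffAt.mpr fun y => ?_
    by_cases hy : y ∈ tsupport (η j)
    · exact (hηsm j).contDiffAt.div (hSsm y (hηO j hy)) (by linarith [hS1 y (hηO j hy)])
    · exact contDiffAt_const.congr_of_eventuallyEq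
        (notMem_tsupport_iff_eventuallyEq.mp fun h => hy (hψts j h))
  refine ⟨⟨J, x, fun j y => η j y / S y, hxO, fun j hj => ?_, hψsm, fun j y => ?_, fun j hj => ?_,
    fun j hj y => ?_, fun j hj => ?_, fun y hy => ?_, hdisj⟩⟩
  · ext y; simp [hηJc j hj]
  · exact div_nonneg (hη0 j y) (tsum_nonneg fun i => hη0 i y)
  · exact (hψts j).trans (hηts j hj).subset
  · have hj0 := hd0 j hj
    by_cases hy : y ∈ tsupport (η j)
    · have hyO := hηO j hy
      have hS1y := hS1 y hyO
      have h1 : HasFDerivAt (η j) (fderiv ℝ (η j) y) y :=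
        ((hηsm j).differentiable (by simp)).differentiableAt.hasFDerivAt
      have h2 : HasFDerivAt S (fderiv ℝ S y) y :=
        ((hSsm y hyO).differentiableAt (by simp)).hasFDerivAt
      have h3 := h1.mul ((hasDerivAt_inv (by linarith : S y ≠ 0)).comp_hasFDerivAt y h2)
      have heq : (fun y => η j y / S y) = η j * (Inv.inv ∘ S) := by
        ext y; rw [div_eq_mul_inv]; rfl
      rw [heq, h3.fderiv]
      refine (norm_add_le _ _).trans ?_
      rw [add_comm, norm_smul, norm_smul, norm_smul, add_div, mul_div_assoc N]
      have hinv : (S y)⁻¹ ≤ 1 := inv_le_one_of_one_le₀ hS1y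
      have hinv0 : 0 ≤ (S y)⁻¹ := by positivity
      refine add_le_add ?_ ?_
      · rw [Function.comp_apply, Real.norm_of_nonneg hinv0]
        exact (mul_le_of_le_one_left (norm_nonneg _) hinv).trans (hηd j hj y)
      · rw [Real.norm_of_nonneg (hη0 j y)]
        refine (mul_le_of_le_one_left (by positivity) (hη1 j y)).trans ?_
        refine (mul_le_of_le_one_left (by positivity) ?_).trans (hSd j hj y hy)
        rw [norm_neg, norm_inv, norm_pow, Real.norm_of_nonneg (by linarith)]
        exact inv_le_one_of_one_le₀ (one_le_pow₀ hS1y)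
    · have : fderiv ℝ (fun y => η j y / S y) y = 0 :=
        image_eq_zero_of_notMem_tsupport fun h => hy (hψts j (tsupport_fderiv_subset ℝ h))
      rw [this, norm_zero]
      positivity
  · have hj0 := hd0 j hj
    have hcs : HasCompactSupport (η j) := by
      rw [HasCompactSupport, hηts j hj]; exact isCompact_closedBall _ _
    have hψi : Integrable (fun y => η j y / S y) :=
      (hψsm j).continuous.integrable_of_hasCompactSupport
        (hcs.of_isClosed_subset (isClosed_tsupport _) (hψts j))
    have hηi : Integrable (η j) := (hηsm j).continuous.integrable_of_hasCompactSupport hcs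
    calc unitVol n / (N * 32 ^ n) * d j ^ n = (unitVol n * (d j / 32) ^ n) / N := by
          rw [div_pow]; field_simp
      _ ≤ (∫ y, η j y) / N := by
          gcongr
          rw [← volume_real_closedBall_eq (x j) (by linarith : 0 < d j / 32), hηJ j hj]
          exact (φ j hj).measure_closedBall_le_integral volume
      _ = ∫ y, η j y / N := (integral_div _ _).symm
      _ ≤ ∫ y, η j y / S y := by
          refine integral_mono (hηi.div_const N) hψi fun y => ?_
          by_cases hy : η j y = 0
          · simp [hy]
          · have hyO := hηO j (subset_tsupport _ hy)
            exact div_le_div_of_nonneg_left (hη0 j y) (by linarith [hS1 y hyO]) (hSN y hyO)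
  · have := (hsummable y hy).hasSum.div_const (S y)
    rwa [show (∑' j, η j y) = S y from rfl, div_self (by linarith [hS1 y hy])] at this

/-! ### Replacing a function by local averages on one open set. -/

namespace WhitneyPartition

variable {K c : ℝ} {O : Set (EuclideanSpace ℝ (Fin n))}

theorem tsupport_bump_subset (W : WhitneyPartition K c O) (hO : IsOpen O) (hne : Oᶜ.Nonempty)
    (j : ℕ) : tsupport (W.bump j) ⊆ O := by
  by_cases hj : j ∈ W.index
  · intro y hy
    have hd := infDist_compl_pos hO hne (W.center_mem j hj)
    have h2 := W.tsupport_subset j hj hy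
    apply mem_of_infDist_compl_pos
    have h1 : Metric.infDist (W.center j) Oᶜ ≤ Metric.infDist y Oᶜ + dist (W.center j) y :=
      Metric.infDist_le_infDist_add_dist
    rw [Metric.mem_closedBall, dist_comm] at h2
    linarith
  · rw [W.bump_eq_zero j hj]; simp

theorem bump_apply_eq_zero (W : WhitneyPartition K c O) (hO : IsOpen O) (hne : Oᶜ.Nonempty)
    (j : ℕ) {y : E} (hy : y ∉ O) : W.bump j y = 0 :=
  image_eq_zero_of_notMem_tsupport fun h => hy (W.tsupport_bump_subset hO hne j h)

theorem hasCompactSupport_bump (W : WhitneyPartition K c O) (j : ℕ) :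
    HasCompactSupport (W.bump j) := by
  by_cases hj : j ∈ W.index
  · exact (isCompact_closedBall _ _).of_isClosed_subset (isClosed_tsupport _)
      (W.tsupport_subset j hj)
  · rw [W.bump_eq_zero j hj]; exact HasCompactSupport.zero

theorem sum_bump_le_one (W : WhitneyPartition K c O) (hO : IsOpen O) (hne : Oᶜ.Nonempty)
    (y : E) (F : Finset ℕ) : ∑ j ∈ F, W.bump j y ≤ 1 := by
  by_cases hy : y ∈ O
  · exact sum_le_hasSum F (fun j _ => W.nonneg j y) (W.hasSum_one y hy)
  · simp [W.bump_apply_eq_zero hO hne _ hy]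

theorem bump_le_one (W : WhitneyPartition K c O) (hO : IsOpen O) (hne : Oᶜ.Nonempty)
    (j : ℕ) (y : E) : W.bump j y ≤ 1 := by
  simpa using W.sum_bump_le_one hO hne y {j}

/-- Size of the bumps' supports relative to the distance to the complement. -/
theorem dist_le_of_mem_tsupport (W : WhitneyPartition K c O) (hO : IsOpen O) (hne : Oᶜ.Nonempty)
    {j : ℕ} (hj : j ∈ W.index) {u z : E} (hu : u ∈ tsupport (W.bump j))
    (hz : z ∈ tsupport (W.bump j)) : dist u z ≤ Metric.infDist z Oᶜ := by
  have hd := infDist_compl_pos hO hne (W.center_mem j hj)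
  have h1 := W.tsupport_subset j hj hu
  have h2 := W.tsupport_subset j hj hz
  have h3 : Metric.infDist (W.center j) Oᶜ ≤ Metric.infDist z Oᶜ + dist (W.center j) z :=
    Metric.infDist_le_infDist_add_dist
  rw [Metric.mem_closedBall] at h1 h2
  have := dist_triangle_right u z (W.center j)
  rw [dist_comm] at h3
  linarith

theorem exists_finset_eventually (W : WhitneyPartition K c O) (hO : IsOpen O) (hne : Oᶜ.Nonempty)
    {y : E} (hy : y ∈ O) : ∃ T : Finset ℕ, ∀ᶠ z in 𝓝 y, ∀ j ∉ T, W.bump j z = 0 := by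
  obtain ⟨T, _, _, hT⟩ := exists_finset_whitney hO hne W.pairwiseDisjoint hy
  have hD := infDist_compl_pos hO hne hy
  refine ⟨T, ?_⟩
  filter_upwards [Metric.ball_mem_nhds y (show 0 < Metric.infDist y Oᶜ / 8 by positivity)]
    with z hz j hjT
  by_cases hj : j ∈ W.index
  · exact image_eq_zero_of_notMem_tsupport fun h => hT z hz j hj hjT (W.tsupport_subset j hj h)
  · rw [W.bump_eq_zero j hj]; rfl

theorem exists_finset (W : WhitneyPartition K c O) (hO : IsOpen O) (hne : Oᶜ.Nonempty)
    (y : E) : ∃ T : Finset ℕ, ∀ j ∉ T, W.bump j y = 0 := by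
  by_cases hy : y ∈ O
  · obtain ⟨T, hT⟩ := W.exists_finset_eventually hO hne hy
    exact ⟨T, hT.self_of_nhds⟩
  · exact ⟨∅, fun j _ => W.bump_apply_eq_zero hO hne j hy⟩

theorem integrable_bump_smul (W : WhitneyPartition K c O) (j : ℕ) {g : E → 𝕜}
    (hg : LocallyIntegrable g volume) : Integrable (fun z => W.bump j z • g z) :=
  hg.integrable_smul_left_of_hasCompactSupport (W.contDiff j).continuous
    (W.hasCompactSupport_bump j)

theorem integrable_bump (W : WhitneyPartition K c O) (j : ℕ) : Integrable (W.bump j) :=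
  (W.contDiff j).continuous.integrable_of_hasCompactSupport (W.hasCompactSupport_bump j)

theorem integral_bump_pos (W : WhitneyPartition K c O) (hO : IsOpen O) (hne : Oᶜ.Nonempty)
    (hc : 0 < c) {j : ℕ} (hj : j ∈ W.index) : 0 < ∫ z, W.bump j z := by
  have hd := infDist_compl_pos hO hne (W.center_mem j hj)
  exact lt_of_lt_of_le (by positivity) (W.le_integral j hj)

/-- The average of `g` with respect to the `j`-th bump. -/
def avg (W : WhitneyPartition K c O) (g : E → 𝕜) (j : ℕ) : 𝕜 :=
  (∫ z, W.bump j z)⁻¹ • ∫ z, W.bump j z • g z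

/-- The function `g` with its values on `O` replaced by local averages on Whitney balls. -/
def smoothing (W : WhitneyPartition K c O) (g : E → 𝕜) (y : E) : 𝕜 :=
  Set.indicator Oᶜ g y + ∑' j, W.bump j y • W.avg g j

theorem integral_bump_smul_avg (W : WhitneyPartition K c O) (hO : IsOpen O) (hne : Oᶜ.Nonempty)
    (hc : 0 < c) (g : E → 𝕜) (j : ℕ) :
    ∫ z, W.bump j z • W.avg g j = ∫ z, W.bump j z • g z := by
  by_cases hj : j ∈ W.index
  · rw [integral_smul_const, avg, smul_inv_smul₀ (W.integral_bump_pos hO hne hc hj).ne']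
  · simp [W.bump_eq_zero j hj]

theorem norm_avg_sub_le (W : WhitneyPartition K c O) (hO : IsOpen O) (hne : Oᶜ.Nonempty)
    (hc : 0 < c) {g : E → 𝕜} (hg : LocallyIntegrable g volume) {j : ℕ} (hj : j ∈ W.index)
    {a : 𝕜} {ε : ℝ} (h : ∀ u ∈ tsupport (W.bump j), ‖g u - a‖ ≤ ε) : ‖W.avg g j - a‖ ≤ ε := by
  have hpos := W.integral_bump_pos hO hne hc hj
  have h1 : W.avg g j - a = (∫ z, W.bump j z)⁻¹ • ∫ z, W.bump j z • (g z - a) := by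
    simp only [smul_sub]
    rw [integral_sub (W.integrable_bump_smul j hg) ((W.integrable_bump j).smul_const a),
      integral_smul_const, smul_sub, inv_smul_smul₀ hpos.ne', avg]
  have h2 : ‖∫ z, W.bump j z • (g z - a)‖ ≤ ∫ z, W.bump j z * ε := by
    refine norm_integral_le_of_norm_le ((W.integrable_bump j).mul_const ε)
      (Eventually.of_forall fun z => ?_)
    rw [norm_smul, Real.norm_of_nonneg (W.nonneg j z)]
    by_cases hz : z ∈ tsupport (W.bump j)
    · exact mul_le_mul_of_nonneg_left (h z hz) (W.nonneg j z)
    · simp [image_eq_zero_of_notMem_tsupport hz]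
  rw [h1, norm_smul, norm_inv, Real.norm_of_nonneg hpos.le, inv_mul_le_iff₀ hpos]
  rwa [integral_mul_const] at h2

theorem summable_bump_smul (W : WhitneyPartition K c O) (hO : IsOpen O) (hne : Oᶜ.Nonempty)
    (y : E) (v : ℕ → 𝕜) : Summable fun j => W.bump j y • v j := by
  obtain ⟨T, hT⟩ := W.exists_finset hO hne y
  exact summable_of_ne_finset_zero (s := T) fun j hj => by rw [hT j hj, zero_smul]

theorem norm_tsum_bump_smul_sub_le (W : WhitneyPartition K c O) (hO : IsOpen O)
    (hne : Oᶜ.Nonempty) {y : E} (hy : y ∈ O) {v : ℕ → 𝕜} {a : 𝕜} {ε : ℝ}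
    (h : ∀ j ∈ W.index, y ∈ tsupport (W.bump j) → ‖v j - a‖ ≤ ε) :
    ‖∑' j, W.bump j y • v j - a‖ ≤ ε := by
  have h1 : HasSum (fun j => W.bump j y • (v j - a)) (∑' j, W.bump j y • v j - a) := by
    simp only [smul_sub]
    have := (W.hasSum_one y hy).smul_const a
    rw [one_smul] at this
    exact (W.summable_bump_smul hO hne y v).hasSum.sub this
  have h2 : HasSum (fun j => W.bump j y * ε) ε := by
    simpa using (W.hasSum_one y hy).mul_right ε
  refine h1.norm_le_of_bounded h2 fun j => ?_
  rw [norm_smul, Real.norm_of_nonneg (W.nonneg j y)]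
  by_cases hj : j ∈ W.index
  · by_cases hz : y ∈ tsupport (W.bump j)
    · exact mul_le_mul_of_nonneg_left (h j hj hz) (W.nonneg j y)
    · simp [image_eq_zero_of_notMem_tsupport hz]
  · simp [W.bump_eq_zero j hj]

theorem tsum_bump_smul_eq_zero (W : WhitneyPartition K c O) (hO : IsOpen O) (hne : Oᶜ.Nonempty)
    {y : E} (hy : y ∉ O) (v : ℕ → 𝕜) : ∑' j, W.bump j y • v j = 0 := by
  simp [W.bump_apply_eq_zero hO hne _ hy]

theorem smoothing_apply_of_notMem (W : WhitneyPartition K c O) (hO : IsOpen O) (hne : Oᶜ.Nonempty)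
    (g : E → 𝕜) {y : E} (hy : y ∉ O) : W.smoothing g y = g y := by
  rw [smoothing, W.tsum_bump_smul_eq_zero hO hne hy, add_zero,
    Set.indicator_of_mem (Set.mem_compl hy)]

theorem smoothing_apply_of_mem (W : WhitneyPartition K c O) (g : E → 𝕜) {y : E} (hy : y ∈ O) :
    W.smoothing g y = ∑' j, W.bump j y • W.avg g j := by
  rw [smoothing, Set.indicator_of_notMem (Set.notMem_compl_iff.mpr hy), zero_add]

theorem norm_smoothing_le (W : WhitneyPartition K c O) (hO : IsOpen O) (hne : Oᶜ.Nonempty)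
    {g : E → 𝕜} {M : ℝ} (h1 : ∀ y ∉ O, ‖g y‖ ≤ M) (h2 : ∀ j ∈ W.index, ‖W.avg g j‖ ≤ M)
    (y : E) : ‖W.smoothing g y‖ ≤ M := by
  by_cases hy : y ∈ O
  · rw [W.smoothing_apply_of_mem g hy, ← sub_zero (∑' j, _)]
    exact W.norm_tsum_bump_smul_sub_le hO hne hy fun j hj _ => by simpa using h2 j hj
  · rw [W.smoothing_apply_of_notMem hO hne g hy]
    exact h1 y hy

/-- Inside O the sum is locally finite. At y ∉ O, the bumps active at a nearby z ∈ O have supports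
within dist(z, Oᶜ) ≤ |z - y| of z, so their averages only see values of g within 2|z - y| of y. -/
theorem continuous_smoothing (W : WhitneyPartition K c O) (hO : IsOpen O) (hne : Oᶜ.Nonempty)
    (hc : 0 < c) {g : E → 𝕜} (hg : Continuous g) : Continuous (W.smoothing g) := by
  refine continuous_iff_continuousAt.mpr fun y => ?_
  by_cases hy : y ∈ O
  · obtain ⟨T, hT⟩ := W.exists_finset_eventually hO hne hy
    have heq : W.smoothing g =ᶠ[𝓝 y] fun z => ∑ j ∈ T, W.bump j z • W.avg g j := by
      filter_upwards [hT, hO.mem_nhds hy] with z hz hzO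
      rw [W.smoothing_apply_of_mem g hzO]
      exact tsum_eq_sum fun j hj => by rw [hz j hj, zero_smul]
    refine ContinuousAt.congr ?_ heq.symm
    exact (continuous_finsetSum _ fun j _ =>
      (W.contDiff j).continuous.smul continuous_const).continuousAt
  · rw [Metric.continuousAt_iff, W.smoothing_apply_of_notMem hO hne g hy]
    intro ε hε
    obtain ⟨δ, hδ, hgδ⟩ := Metric.continuousAt_iff.mp hg.continuousAt (ε / 2) (half_pos hε)
    refine ⟨δ / 2, half_pos hδ, fun z hz => ?_⟩
    by_cases hzO : z ∈ O
    · rw [W.smoothing_apply_of_mem g hzO, dist_eq_norm]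
      refine lt_of_le_of_lt (W.norm_tsum_bump_smul_sub_le hO hne hzO fun j hj hzj => ?_)
        (half_lt_self hε)
      refine W.norm_avg_sub_le hO hne hc hg.locallyIntegrable hj fun u hu => ?_
      rw [← dist_eq_norm]
      refine (hgδ ?_).le
      have h1 := W.dist_le_of_mem_tsupport hO hne hj hu hzj
      have h2 := Metric.infDist_le_dist_of_mem (x := z) (Set.mem_compl hy)
      linarith [dist_triangle u z y]
    · rw [W.smoothing_apply_of_notMem hO hne g hzO]
      exact (hgδ (by linarith)).trans (half_lt_self hε)

theorem summable_integral_norm_bump_smul (W : WhitneyPartition K c O) (hO : IsOpen O)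
    (hne : Oᶜ.Nonempty) {g : E → 𝕜} (hg : Integrable g) :
    Summable fun j => ∫ z, ‖W.bump j z • g z‖ := by
  refine summable_of_sum_le (c := ∫ z, ‖g z‖)
    (fun j => integral_nonneg fun z => norm_nonneg _) fun F => ?_
  rw [← integral_finsetSum _ fun j _ => (W.integrable_bump_smul j hg.locallyIntegrable).norm]
  refine integral_mono (integrable_finsetSum _ fun j _ =>
    (W.integrable_bump_smul j hg.locallyIntegrable).norm) hg.norm fun z => ?_
  simp only [norm_smul, Real.norm_of_nonneg (W.nonneg _ z)]
  rw [← Finset.sum_mul]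
  exact mul_le_of_le_one_left (norm_nonneg _) (W.sum_bump_le_one hO hne z F)

theorem hasSum_integral_bump_smul (W : WhitneyPartition K c O) (hO : IsOpen O)
    (hne : Oᶜ.Nonempty) {g : E → 𝕜} (hg : Integrable g) :
    HasSum (fun j => ∫ z, W.bump j z • g z) (∫ z in O, g z) := by
  have h := hasSum_integral_of_summable_integral_norm
    (fun j => W.integrable_bump_smul j hg.locallyIntegrable)
    (W.summable_integral_norm_bump_smul hO hne hg)
  have heq : ∫ z in O, g z = ∫ z, ∑' j, W.bump j z • g z := by
    rw [← integral_indicator hO.measurableSet]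
    congr 1 with z
    by_cases hz : z ∈ O
    · rw [Set.indicator_of_mem hz]
      have := (W.hasSum_one z hz).smul_const (g z)
      rw [one_smul] at this
      exact this.tsum_eq.symm
    · rw [Set.indicator_of_notMem hz, W.tsum_bump_smul_eq_zero hO hne hz]
  rw [heq]
  exact h

theorem aestronglyMeasurable_smoothing (W : WhitneyPartition K c O) (hO : IsOpen O)
    (hne : Oᶜ.Nonempty) {g : E → 𝕜} (hg : AEStronglyMeasurable g) :
    AEStronglyMeasurable (W.smoothing g) := by
  refine (hg.indicator hO.measurableSet.compl).add ?_
  refine aestronglyMeasurable_of_tendsto_ae atTop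
    (f := fun k : ℕ => fun y => ∑ j ∈ Finset.range k, W.bump j y • W.avg g j) (fun k => ?_)
    (Eventually.of_forall fun y =>
      (W.summable_bump_smul hO hne y _).hasSum.tendsto_sum_nat)
  exact (continuous_finsetSum _ fun j _ =>
    (W.contDiff j).continuous.smul continuous_const).aestronglyMeasurable

/-- Each term φ_j · avg_j has the integral of φ_j g, and these add up to the integral of g over O.
This is the source of the cancellation of the atoms. -/
theorem integral_smoothing (W : WhitneyPartition K c O) (hO : IsOpen O)
    (hne : Oᶜ.Nonempty) (hc : 0 < c) {g : E → 𝕜} (hg : Integrable g)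
    (hs : Integrable (W.smoothing g)) : ∫ z, W.smoothing g z = ∫ z, g z := by
  have hint : ∀ j, Integrable fun z => W.bump j z • W.avg g j := fun j =>
    (W.integrable_bump j).smul_const _
  have hle : ∀ j, ∫ z, ‖W.bump j z • W.avg g j‖ ≤ ∫ z, ‖W.bump j z • g z‖ := by
    intro j
    have h1 : ∫ z, ‖W.bump j z • W.avg g j‖ = ‖∫ z, W.bump j z • W.avg g j‖ := by
      simp only [norm_smul, Real.norm_of_nonneg (W.nonneg j _)]
      rw [integral_mul_const, integral_smul_const, norm_smul,
        Real.norm_of_nonneg (integral_nonneg (W.nonneg j))]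
    rw [h1, W.integral_bump_smul_avg hO hne hc]
    exact norm_integral_le_integral_norm _
  have hsum : Summable fun j => ∫ z, ‖W.bump j z • W.avg g j‖ :=
    (W.summable_integral_norm_bump_smul hO hne hg).of_nonneg_of_le
      (fun j => integral_nonneg fun z => norm_nonneg _) hle
  have h := hasSum_integral_of_summable_integral_norm hint hsum
  simp only [W.integral_bump_smul_avg hO hne hc] at h
  have h2 := h.unique (W.hasSum_integral_bump_smul hO hne hg)
  have hi : Integrable (Set.indicator Oᶜ g) := hg.indicator hO.measurableSet.compl
  have hi2 : Integrable fun z => ∑' j, W.bump j z • W.avg g j := by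
    refine (hs.sub hi).congr (Eventually.of_forall fun z => ?_)
    simp [smoothing]
  calc ∫ z, W.smoothing g z
      = ∫ z, Set.indicator Oᶜ g z + ∑' j, W.bump j z • W.avg g j := rfl
    _ = ∫ z, g z := by
      rw [integral_add hi hi2, h2, integral_indicator hO.measurableSet.compl, add_comm,
        integral_add_compl hO.measurableSet hg]

theorem hasSum_avg_bump_smul {O' : Set E} (W : WhitneyPartition K c O) (W' : WhitneyPartition K c O')
    (hO : IsOpen O) (hne : Oᶜ.Nonempty) (hO' : IsOpen O') (hne' : O'ᶜ.Nonempty) (hsub : O ⊆ O')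
    {f : E → 𝕜} (hf : LocallyIntegrable f volume) (i : ℕ) :
    HasSum (fun j => W.avg (fun z => W'.bump j z • f z) i) (W.avg f i) := by
  refine HasSum.const_smul _ ?_
  have h := W'.hasSum_integral_bump_smul hO' hne' (W.integrable_bump_smul i hf)
  rw [setIntegral_eq_integral_of_forall_compl_eq_zero fun z hz => by
    rw [W.bump_apply_eq_zero hO hne i fun h => hz (hsub h), zero_smul]] at h
  convert h using 3 with j
  funext z
  rw [smul_comm]

/-- The bumps of O' add up to 1 on O', and smoothing is linear. At a fixed y only finitely many
averages over O enter, so the interchange reduces to `hasSum_avg_bump_smul`. -/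
theorem hasSum_smoothing_bump_smul {O' : Set E} (W : WhitneyPartition K c O)
    (W' : WhitneyPartition K c O') (hO : IsOpen O) (hne : Oᶜ.Nonempty) (hO' : IsOpen O')
    (hne' : O'ᶜ.Nonempty) (hsub : O ⊆ O') {f : E → 𝕜} (hf : LocallyIntegrable f volume)
    {y : E} (hy : y ∈ O') :
    HasSum (fun j => W.smoothing (fun z => W'.bump j z • f z) y) (W.smoothing f y) := by
  by_cases hyO : y ∈ O
  · obtain ⟨T, hT⟩ := W.exists_finset hO hne y
    have hs : ∀ g : E → 𝕜, W.smoothing g y = ∑ i ∈ T, W.bump i y • W.avg g i := fun g => by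
      rw [W.smoothing_apply_of_mem g hyO]
      exact tsum_eq_sum fun j hj => by rw [hT j hj, zero_smul]
    simp only [hs]
    exact hasSum_sum fun i _ =>
      (W.hasSum_avg_bump_smul W' hO hne hO' hne' hsub hf i).const_smul _
  · simp only [W.smoothing_apply_of_notMem hO hne _ hyO]
    simpa using (W'.hasSum_one y hy).smul_const (f y)

end WhitneyPartition

/-! ### Pieces attached to nested open sets. -/

namespace WhitneyPartition

variable {K c : ℝ} {O O' : Set (EuclideanSpace ℝ (Fin n))}

/-- If a Whitney ball of `O ⊆ O'` meets a Whitney ball of `O'`, then its radius is controlled. -/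
theorem infDist_le_of_inter (W : WhitneyPartition K c O) (W' : WhitneyPartition K c O')
    (hO : IsOpen O) (hne : Oᶜ.Nonempty) (hne' : O'ᶜ.Nonempty)
    (hsub : O ⊆ O') {i j : ℕ} (hi : i ∈ W.index) (hj : j ∈ W'.index) {z : E}
    (hz : z ∈ tsupport (W.bump i)) (hz' : z ∈ tsupport (W'.bump j)) :
    15 / 16 * Metric.infDist (W.center i) Oᶜ ≤ 17 / 16 * Metric.infDist (W'.center j) O'ᶜ ∧
      dist (W.center i) (W'.center j) ≤ Metric.infDist (W.center i) Oᶜ / 16 +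
        Metric.infDist (W'.center j) O'ᶜ / 16 := by
  have hd := infDist_compl_pos hO hne (W.center_mem i hi)
  have h1 := W.tsupport_subset i hi hz
  have h2 := W'.tsupport_subset j hj hz'
  rw [Metric.mem_closedBall] at h1 h2
  have h3 : Metric.infDist (W.center i) Oᶜ ≤ Metric.infDist (W.center i) O'ᶜ :=
    Metric.infDist_le_infDist_of_subset (Set.compl_subset_compl.mpr hsub) hne'
  have h4 : Metric.infDist (W.center i) O'ᶜ ≤ Metric.infDist (W'.center j) O'ᶜ +
    dist (W.center i) (W'.center j) := Metric.infDist_le_infDist_add_dist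
  have h5 := dist_triangle_left (W.center i) (W'.center j) z
  exact ⟨by linarith, by linarith⟩

theorem bump_mul_bump_tsupport_subset (W : WhitneyPartition K c O) (W' : WhitneyPartition K c O')
    (i j : ℕ) : tsupport (fun z => W.bump i z * W'.bump j z) ⊆ tsupport (W.bump i) :=
  closure_mono fun z hz h => hz (by simp [h])

/-- Where both supports meet, d_i ≤ (17/15) d'_j ≤ 2 d'_j, so the coarser bump contributes at most
2K/d_i and the product can be tested at the scale d_i of the inner set. -/
theorem norm_fderiv_bump_mul_bump_le (W : WhitneyPartition K c O) (W' : WhitneyPartition K c O')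
    (hK : 0 < K) (hO : IsOpen O) (hne : Oᶜ.Nonempty) (hO' : IsOpen O') (hne' : O'ᶜ.Nonempty)
    (hsub : O ⊆ O') {i j : ℕ} (hi : i ∈ W.index) (hj : j ∈ W'.index) (z : E) :
    ‖fderiv ℝ (fun z => W.bump i z * W'.bump j z) z‖ ≤
      3 * K / Metric.infDist (W.center i) Oᶜ := by
  have hd := infDist_compl_pos hO hne (W.center_mem i hi)
  have hd' := infDist_compl_pos hO' hne' (W'.center_mem j hj)
  have h1 : HasFDerivAt (W.bump i) (fderiv ℝ (W.bump i) z) z :=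
    ((W.contDiff i).differentiable (by simp)).differentiableAt.hasFDerivAt
  have h2 : HasFDerivAt (W'.bump j) (fderiv ℝ (W'.bump j) z) z :=
    ((W'.contDiff j).differentiable (by simp)).differentiableAt.hasFDerivAt
  rw [(h1.fun_mul h2).fderiv]
  refine (norm_add_le _ _).trans ?_
  rw [norm_smul, norm_smul, Real.norm_of_nonneg (W.nonneg i z),
    Real.norm_of_nonneg (W'.nonneg j z)]
  by_cases hz : z ∈ tsupport (W.bump i)
  · have hb2 : W'.bump j z * ‖fderiv ℝ (W.bump i) z‖ ≤ K / Metric.infDist (W.center i) Oᶜ :=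
      (mul_le_of_le_one_left (norm_nonneg _) (W'.bump_le_one hO' hne' j z)).trans
        (W.norm_fderiv_le i hi z)
    have hb1 : W.bump i z * ‖fderiv ℝ (W'.bump j) z‖ ≤
        2 * K / Metric.infDist (W.center i) Oᶜ := by
      refine (mul_le_of_le_one_left (norm_nonneg _) (W.bump_le_one hO hne i z)).trans ?_
      by_cases hz' : z ∈ tsupport (W'.bump j)
      · refine (W'.norm_fderiv_le j hj z).trans ?_
        have := (W.infDist_le_of_inter W' hO hne hne' hsub hi hj hz hz').1
        rw [div_le_div_iff₀ hd' hd]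
        nlinarith
      · have : fderiv ℝ (W'.bump j) z = 0 :=
          image_eq_zero_of_notMem_tsupport fun h => hz' (tsupport_fderiv_subset ℝ h)
        rw [this, norm_zero]
        positivity
    calc _ ≤ 2 * K / Metric.infDist (W.center i) Oᶜ + K / Metric.infDist (W.center i) Oᶜ :=
          add_le_add hb1 hb2
      _ = _ := by ring
  · have : fderiv ℝ (W.bump i) z = 0 :=
      image_eq_zero_of_notMem_tsupport fun h => hz (tsupport_fderiv_subset ℝ h)
    rw [this, image_eq_zero_of_notMem_tsupport hz]
    simp only [zero_mul, norm_zero, mul_zero, add_zero]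
    positivity

/-- The `j`-th piece of the difference of the smoothings of `f` with respect to `O ⊆ O'`. -/
def piece (W : WhitneyPartition K c O) (W' : WhitneyPartition K c O') (f : E → 𝕜) (j : ℕ) :
    E → 𝕜 :=
  fun y => W.smoothing (fun z => W'.bump j z • f z) y - W'.bump j y • W'.avg f j

theorem avg_eq_zero_of_disjoint (W : WhitneyPartition K c O) (W' : WhitneyPartition K c O')
    (f : E → 𝕜) {i j : ℕ} (h : ∀ z ∈ tsupport (W.bump i), z ∉ tsupport (W'.bump j)) :
    W.avg (fun z => W'.bump j z • f z) i = 0 := by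
  have : ∀ z, W.bump i z • W'.bump j z • f z = 0 := by
    intro z
    by_cases hz : z ∈ tsupport (W.bump i)
    · rw [image_eq_zero_of_notMem_tsupport (h z hz), zero_smul, smul_zero]
    · rw [image_eq_zero_of_notMem_tsupport hz, zero_smul]
  simp [avg, this]

theorem piece_eq_zero_of_notMem_index (W : WhitneyPartition K c O)
    (W' : WhitneyPartition K c O') (f : E → 𝕜) {j : ℕ} (hj : j ∉ W'.index) :
    W.piece W' f j = 0 := by
  funext y
  simp [piece, smoothing, avg, W'.bump_eq_zero j hj]

theorem piece_apply_eq_zero (W : WhitneyPartition K c O) (W' : WhitneyPartition K c O')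
    (hO : IsOpen O) (hne : Oᶜ.Nonempty) (hO' : IsOpen O') (hne' : O'ᶜ.Nonempty)
    (hsub : O ⊆ O') (f : E → 𝕜) (j : ℕ) {y : E} (hy : y ∉ O') : W.piece W' f j y = 0 := by
  rw [piece, W.smoothing_apply_of_notMem hO hne _ fun h => hy (hsub h),
    W'.bump_apply_eq_zero hO' hne' j hy, zero_smul, zero_smul, sub_zero]

/-- Only inner balls meeting supp φ'_j contribute, and they have d_i ≤ (17/15) d'_j. Points of the
piece thus lie within d_i/8 + d'_j/16 < (5/16) d'_j of the centre; 3/8 makes the enclosing ball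
open. -/
theorem tsupport_piece_subset (W : WhitneyPartition K c O) (W' : WhitneyPartition K c O')
    (hO : IsOpen O) (hne : Oᶜ.Nonempty) (hO' : IsOpen O') (hne' : O'ᶜ.Nonempty)
    (hsub : O ⊆ O') (f : E → 𝕜) {j : ℕ} (hj : j ∈ W'.index) :
    tsupport (W.piece W' f j) ⊆
      Metric.ball (W'.center j) (3 / 8 * Metric.infDist (W'.center j) O'ᶜ) := by
  have hd' := infDist_compl_pos hO' hne' (W'.center_mem j hj)
  refine (closure_minimal (t := Metric.closedBall (W'.center j)
    (5 / 16 * Metric.infDist (W'.center j) O'ᶜ)) (fun y hy => ?_)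
    Metric.isClosed_closedBall).trans (Metric.closedBall_subset_ball (by linarith))
  by_cases hyj : y ∈ tsupport (W'.bump j)
  · exact Metric.closedBall_subset_closedBall (by linarith) (W'.tsupport_subset j hj hyj)
  have h0 : W'.bump j y = 0 := image_eq_zero_of_notMem_tsupport hyj
  have hy' : W.smoothing (fun z => W'.bump j z • f z) y ≠ 0 := by
    intro h
    exact hy (by rw [piece, h, h0, zero_smul, sub_zero])
  by_cases hyO : y ∈ O
  · rw [W.smoothing_apply_of_mem _ hyO] at hy'
    obtain ⟨i, hi⟩ : ∃ i, W.bump i y • W.avg (fun z => W'.bump j z • f z) i ≠ 0 := by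
      by_contra! h
      exact hy' (by simp [h])
    have hyi : y ∈ tsupport (W.bump i) := by
      by_contra h
      exact hi (by rw [image_eq_zero_of_notMem_tsupport h, zero_smul])
    have hiW : i ∈ W.index := by
      by_contra h
      exact hi (by simp [W.bump_eq_zero i h])
    obtain ⟨z, hz, hz'⟩ : ∃ z ∈ tsupport (W.bump i), z ∈ tsupport (W'.bump j) := by
      by_contra! h
      exact hi (by rw [W.avg_eq_zero_of_disjoint W' f h, smul_zero])
    obtain ⟨h1, h2⟩ := W.infDist_le_of_inter W' hO hne hne' hsub hiW hj hz hz'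
    have h3 := W.tsupport_subset i hiW hyi
    rw [Metric.mem_closedBall] at h3 ⊢
    have := dist_triangle y (W.center i) (W'.center j)
    linarith
  · rw [W.smoothing_apply_of_notMem hO hne _ hyO, h0, zero_smul] at hy'
    exact absurd rfl hy'

theorem aestronglyMeasurable_piece (W : WhitneyPartition K c O) (W' : WhitneyPartition K c O')
    (hO : IsOpen O) (hne : Oᶜ.Nonempty) {f : E → 𝕜} (hf : LocallyIntegrable f volume) (j : ℕ) :
    AEStronglyMeasurable (W.piece W' f j) :=
  (W.aestronglyMeasurable_smoothing hO hne (W'.integrable_bump_smul j hf).1).sub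
    ((W'.contDiff j).continuous.smul continuous_const).aestronglyMeasurable

theorem continuous_piece (W : WhitneyPartition K c O) (W' : WhitneyPartition K c O')
    (hO : IsOpen O) (hne : Oᶜ.Nonempty) (hc : 0 < c) {f : E → 𝕜} (hf : Continuous f) (j : ℕ) :
    Continuous (W.piece W' f j) :=
  (W.continuous_smoothing hO hne hc ((W'.contDiff j).continuous.smul hf)).sub
    ((W'.contDiff j).continuous.smul continuous_const)

theorem integral_piece (W : WhitneyPartition K c O) (W' : WhitneyPartition K c O')
    (hO : IsOpen O) (hne : Oᶜ.Nonempty) (hO' : IsOpen O') (hne' : O'ᶜ.Nonempty) (hc : 0 < c)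
    {f : E → 𝕜} (hf : LocallyIntegrable f volume) (j : ℕ) (hi : Integrable (W.piece W' f j)) :
    ∫ y, W.piece W' f j y = 0 := by
  have h2 : Integrable fun y => W'.bump j y • W'.avg f j := (W'.integrable_bump j).smul_const _
  have h1 : Integrable (W.smoothing fun z => W'.bump j z • f z) := by
    refine (hi.add h2).congr (Eventually.of_forall fun y => ?_)
    simp [piece]
  simp only [piece]
  rw [integral_sub h1 h2, W.integral_smoothing hO hne hc (W'.integrable_bump_smul j hf) h1,
    W'.integral_bump_smul_avg hO' hne' hc, sub_self]

/-- Outside O' both smoothings agree with f and every piece vanishes; inside, the bumps of O' sum to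
1. -/
theorem hasSum_piece (W : WhitneyPartition K c O) (W' : WhitneyPartition K c O')
    (hO : IsOpen O) (hne : Oᶜ.Nonempty) (hO' : IsOpen O') (hne' : O'ᶜ.Nonempty)
    (hsub : O ⊆ O') {f : E → 𝕜} (hf : LocallyIntegrable f volume) (y : E) :
    HasSum (fun j : W'.index => W.piece W' f j y) (W.smoothing f y - W'.smoothing f y) := by
  have hsupp : Function.support (fun j => W.piece W' f j y) ⊆ W'.index := by
    intro j hj
    by_contra h
    exact hj (congrFun (W.piece_eq_zero_of_notMem_index W' f h) y)
  refine (hasSum_subtype_iff_of_support_subset hsupp).mpr ?_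
  by_cases hy : y ∈ O'
  · rw [W'.smoothing_apply_of_mem f hy]
    exact (W.hasSum_smoothing_bump_smul W' hO hne hO' hne' hsub hf hy).sub
      (W'.summable_bump_smul hO' hne' y _).hasSum
  · rw [W.smoothing_apply_of_notMem hO hne f fun h => hy (hsub h),
      W'.smoothing_apply_of_notMem hO' hne' f hy, sub_self]
    simp only [W.piece_apply_eq_zero W' hO hne hO' hne' hsub f _ hy]
    exact hasSum_zero

theorem norm_piece_le (W : WhitneyPartition K c O) (W' : WhitneyPartition K c O')
    (hO : IsOpen O) (hne : Oᶜ.Nonempty) (hO' : IsOpen O') (hne' : O'ᶜ.Nonempty) {f : E → 𝕜}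
    {M : ℝ} (j : ℕ) (h1 : ∀ y ∉ O, ‖f y‖ ≤ M)
    (h2 : ∀ i ∈ W.index, ‖W.avg (fun z => W'.bump j z • f z) i‖ ≤ M) (h3 : ‖W'.avg f j‖ ≤ M)
    (y : E) : ‖W.piece W' f j y‖ ≤ 2 * M := by
  rw [piece, two_mul]
  refine (norm_sub_le _ _).trans (add_le_add (W.norm_smoothing_le hO hne (fun y hy => ?_) h2 y) ?_)
  · rw [norm_smul, Real.norm_of_nonneg (W'.nonneg j y)]
    exact (mul_le_of_le_one_left (norm_nonneg _) (W'.bump_le_one hO' hne' j y)).trans (h1 y hy)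
  · rw [norm_smul, Real.norm_of_nonneg (W'.nonneg j y)]
    exact (mul_le_of_le_one_left (norm_nonneg _) (W'.bump_le_one hO' hne' j y)).trans h3

end WhitneyPartition

/-! ### Size estimates on the superlevel sets. -/

theorem ofReal_two_zpow (m : ℤ) : ENNReal.ofReal ((2 : ℝ) ^ m) = (2 : ℝ≥0∞) ^ m := by
  cases m with
  | ofNat k => simp [ENNReal.ofReal_pow]
  | negSucc k =>
    rw [zpow_negSucc, zpow_negSucc, ENNReal.ofReal_inv_of_pos (by positivity),
      ENNReal.ofReal_pow (by norm_num)]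
    simp

/-- Testing `f` against a smooth function adapted to a Whitney ball of a superlevel set of the
grand maximal function. -/
theorem norm_integral_smul_le_of_levelSet {A b : ℝ} (hA : 0 < A) (hb : 1 < b) {f : E → 𝕜}
    {m : ℤ} (hne : (levelSet A b f m)ᶜ.Nonempty) {x : E} (hx : 0 < distCompl A b f m x)
    {ψ : E → ℝ} (hψ : ContDiff ℝ ∞ ψ) {L : ℝ} (hL : 0 < L)
    (hsupp : tsupport ψ ⊆ Metric.closedBall x (distCompl A b f m x / 16))
    (hder : ∀ z, ‖fderiv ℝ ψ z‖ ≤ L / distCompl A b f m x) :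
    ‖∫ z, ψ z • f z‖ ≤ L / A * distCompl A b f m x ^ n * 2 ^ m := by
  set d := distCompl A b f m x with hd
  -- Here b > 1 enters: a point of the complement at distance less than b·d exists, and the cone of
  -- w reaches x at scale d.
  obtain ⟨w, hw, hxw⟩ := (Metric.infDist_lt_iff hne).mp
    (show Metric.infDist x (levelSet A b f m)ᶜ < b * d by
      change d < b * d
      nlinarith)
  have h := enorm_integral_smul_le_grandMaximal hA f hψ hx (div_pos hL hx)
    (hsupp.trans (Metric.closedBall_subset_ball (by linarith))) hder hxw
  have hw' : grandMaximal A b f w ≤ ENNReal.ofReal (2 ^ m) := by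
    rw [ofReal_two_zpow]
    exact not_lt.mp hw
  have h2 : ‖∫ z, ψ z • f z‖ₑ ≤ ENNReal.ofReal (L / A * d ^ n * 2 ^ m) := by
    refine h.trans ?_
    rw [ENNReal.ofReal_mul (by positivity)]
    refine mul_le_mul' (le_of_eq ?_) hw'
    congr 1
    field_simp
    ring
  rwa [← ofReal_norm, ENNReal.ofReal_le_ofReal_iff (by positivity)] at h2

/-- Averages against functions adapted to a Whitney ball of a superlevel set. -/
theorem norm_avg_le_of_integral_le {A b K c L : ℝ} (hA : 0 < A) (hL : 0 < L) (hc : 0 < c)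
    {f : E → 𝕜} {m : ℤ} (hne : (levelSet A b f m)ᶜ.Nonempty)
    (W : WhitneyPartition K c (levelSet A b f m)) {i : ℕ} (hi : i ∈ W.index) {g : E → 𝕜}
    (hg : ‖∫ z, W.bump i z • g z‖ ≤ L / A * distCompl A b f m (W.center i) ^ n * 2 ^ m) :
    ‖W.avg g i‖ ≤ L / (A * c) * 2 ^ m := by
  have h1 := W.integral_bump_pos (isOpen_levelSet f m) hne hc hi
  have h2 : c * distCompl A b f m (W.center i) ^ n ≤ ∫ z, W.bump i z := W.le_integral i hi
  rw [WhitneyPartition.avg, norm_smul, norm_inv, Real.norm_of_nonneg h1.le, inv_mul_le_iff₀ h1]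
  refine hg.trans ?_
  calc L / A * distCompl A b f m (W.center i) ^ n * 2 ^ m
      = c * distCompl A b f m (W.center i) ^ n * (L / (A * c) * 2 ^ m) := by
        field_simp
    _ ≤ _ := by gcongr

theorem norm_avg_le_of_levelSet {A b K c : ℝ} (hA : 0 < A) (hb : 1 < b) (hK : 0 < K) (hc : 0 < c)
    {f : E → 𝕜} (hne : ∀ m, (levelSet A b f m)ᶜ.Nonempty)
    (W : ∀ m, WhitneyPartition K c (levelSet A b f m)) {m : ℤ} {j : ℕ} (hj : j ∈ (W m).index) :
    ‖(W m).avg f j‖ ≤ K / (A * c) * 2 ^ m :=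
  norm_avg_le_of_integral_le hA hK hc (hne m) (W m) hj
    (norm_integral_smul_le_of_levelSet hA hb (f := f) (hne m)
      (infDist_compl_pos (isOpen_levelSet f m) (hne m) ((W m).center_mem j hj))
      ((W m).contDiff j) hK ((W m).tsupport_subset j hj) ((W m).norm_fderiv_le j hj))

/-- The pieces of level `m` have size at most a constant times `2^m`. -/
theorem norm_piece_le_of_levelSet {A b K c C : ℝ} (hA : 0 < A) (hb : 1 < b) (hK : 0 < K)
    (hc : 0 < c) {f : E → 𝕜} (hC : 0 < C) (hf : ∀ x, ‖f x‖ₑ ≤ ENNReal.ofReal C * grandMaximal A b f x)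
    (hne : ∀ m, (levelSet A b f m)ᶜ.Nonempty)
    (W : ∀ m, WhitneyPartition K c (levelSet A b f m)) {m : ℤ} {j : ℕ} (hj : j ∈ (W m).index)
    (y : E) :
    ‖(W (m + 1)).piece (W m) f j y‖ ≤ 4 * (C + 3 * K / (A * c)) * 2 ^ m := by
  have hO : ∀ m, IsOpen (levelSet A b f m) := fun m => isOpen_levelSet f m
  have hsub : levelSet A b f (m + 1) ⊆ levelSet A b f m := levelSet_antitone f (by omega)
  have hpos : ∀ m, ∀ i ∈ (W m).index, 0 < distCompl A b f m ((W m).center i) := fun m i hi =>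
    infDist_compl_pos (hO m) (hne m) ((W m).center_mem i hi)
  have h2m : (2 : ℝ) ^ (m + 1) = 2 * 2 ^ m := by
    rw [zpow_add_one₀ (by norm_num), mul_comm]
  -- One bound dominates the values of f off O^(m+1) and the averages at both levels. The factor 4
  -- in the conclusion is 2 for 2^(m+1) times 2 for the two terms of the piece.
  set M : ℝ := (C + 3 * K / (A * c)) * 2 ^ (m + 1) with hM
  have hM2 : 4 * (C + 3 * K / (A * c)) * 2 ^ m = 2 * M := by
    rw [hM, h2m]; ring
  have hM1 : 3 * K / (A * c) * 2 ^ (m + 1) ≤ M := by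
    rw [hM]
    gcongr
    linarith
  have hM0 : K / (A * c) * 2 ^ m ≤ M := by
    refine le_trans ?_ hM1
    gcongr
    · linarith
    · norm_num
    · omega
  rw [hM2]
  refine (W (m + 1)).norm_piece_le (W m) (hO _) (hne _) (hO _) (hne _) j (fun y hy => ?_)
    (fun i hi => ?_) ?_ y
  · have h1 : ‖f y‖ₑ ≤ ENNReal.ofReal (C * 2 ^ (m + 1)) := by
      rw [ENNReal.ofReal_mul hC.le, ofReal_two_zpow]
      refine (hf y).trans ?_
      gcongr
      exact not_lt.mp hy
    rw [← ofReal_norm, ENNReal.ofReal_le_ofReal_iff (by positivity)] at h1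
    refine h1.trans ?_
    rw [hM]
    gcongr
    have : 0 < 3 * K / (A * c) := by positivity
    linarith
  · refine (norm_avg_le_of_integral_le hA (by positivity) hc (hne _) (W _) hi ?_).trans hM1
    have h := norm_integral_smul_le_of_levelSet hA hb (f := f) (hne (m + 1)) (hpos _ i hi)
      (((W (m + 1)).contDiff i).mul ((W m).contDiff j)) (L := 3 * K) (by positivity)
      (((W (m + 1)).bump_mul_bump_tsupport_subset (W m) i j).trans
        ((W (m + 1)).tsupport_subset i hi))
      ((W (m + 1)).norm_fderiv_bump_mul_bump_le (W m) hK (hO _) (hne _) (hO _) (hne _) hsub hi hj)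
    simpa only [mul_smul] using h
  · exact (norm_avg_le_of_levelSet hA hb hK hc hne W hj).trans hM0

/-! ### Pointwise summation of the pieces and summation of the coefficients. -/

theorem sum_Ico_int_sub {G : Type*} [AddCommGroup G] (g : ℤ → G) {a b : ℤ} (hab : a ≤ b) :
    ∑ m ∈ Finset.Ico a b, (g (m + 1) - g m) = g b - g a := by
  induction b, hab using Int.leInduction with
  | base => simp
  | succ b hab ih =>
    rw [← Finset.insert_Ico_right_eq_Ico_add_one hab, Finset.sum_insert (by simp), ih]
    abel

/-- A telescoping series over `ℤ`. -/
theorem eq_of_hasSum_int_telescoping {g : ℤ → 𝕜} {s a : 𝕜}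
    (h : HasSum (fun m => g (m + 1) - g m) s) (htop : Tendsto g atTop (𝓝 a))
    (hbot : Tendsto g atBot (𝓝 0)) : s = a := by
  have h1 : Tendsto (fun M : ℕ => Finset.Ico (-(M : ℤ)) M) atTop atTop := by
    refine tendsto_atTop_finset_of_monotone (fun M M' hM => ?_) fun m => ⟨m.natAbs + 1, ?_⟩
    · exact Finset.Ico_subset_Ico (by omega) (by omega)
    · rw [Finset.mem_Ico]; omega
  have h2 : Tendsto (fun M : ℕ => g M - g (-(M : ℤ))) atTop (𝓝 s) := by
    refine (h.comp h1).congr fun M => ?_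
    exact sum_Ico_int_sub g (by omega)
  have h3 : Tendsto (fun M : ℕ => g M - g (-(M : ℤ))) atTop (𝓝 (a - 0)) :=
    (htop.comp tendsto_natCast_atTop_atTop).sub
      (hbot.comp (tendsto_neg_atTop_atBot.comp tendsto_natCast_atTop_atTop))
  rw [sub_zero] at h3
  exact tendsto_nhds_unique h2 h3

theorem exists_tsum_zpow_lt_le_one :
    ∃ C : ℝ≥0∞, C ≠ 0 ∧ C ≠ ⊤ ∧ ∀ a : ℝ≥0∞,
      ∑' m : ℤ, (if (2 : ℝ≥0∞) ^ m < a then (2 : ℝ≥0∞) ^ m else 0) ≤ C * a := by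
  simpa only [ENNReal.rpow_one] using exists_tsum_zpow_lt_le one_pos

section Decomposition

variable {A b K c C : ℝ} {f : EuclideanSpace ℝ (Fin n) → 𝕜}

/-- The pieces are absolutely summable at each point, with sum dominated by the grand maximal
function. -/
theorem tsum_enorm_piece_le (hA : 0 < A) (hb : 1 < b) (hK : 0 < K)
    (hc : 0 < c) (hC : 0 < C) (hf : ∀ x, ‖f x‖ₑ ≤ ENNReal.ofReal C * grandMaximal A b f x)
    (hne : ∀ m, (levelSet A b f m)ᶜ.Nonempty)
    (W : ∀ m, WhitneyPartition K c (levelSet A b f m)) {D : ℝ≥0∞}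
    (hD : ∀ a : ℝ≥0∞, ∑' m : ℤ, (if (2 : ℝ≥0∞) ^ m < a then (2 : ℝ≥0∞) ^ m else 0) ≤ D * a)
    (y : E) :
    ∑' i : Σ m : ℤ, (W m).index, ‖(W (i.1 + 1)).piece (W i.1) f i.2 y‖ₑ ≤
      (1024 ^ n : ℕ) * ENNReal.ofReal (4 * (C + 3 * K / (A * c))) * D * grandMaximal A b f y := by
  have hO : ∀ m, IsOpen (levelSet A b f m) := fun m => isOpen_levelSet f m
  set B : ℝ≥0∞ := ENNReal.ofReal (4 * (C + 3 * K / (A * c))) with hB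
  rw [ENNReal.tsum_sigma']
  have hm : ∀ m : ℤ, ∑' j : (W m).index, ‖(W (m + 1)).piece (W m) f j y‖ₑ ≤
      (1024 ^ n : ℕ) * B *
        (if (2 : ℝ≥0∞) ^ m < grandMaximal A b f y then (2 : ℝ≥0∞) ^ m else 0) := by
    intro m
    have hsub : levelSet A b f (m + 1) ⊆ levelSet A b f m := levelSet_antitone f (by omega)
    split_ifs with hy
    -- Pieces live on balls of radius 3/8 · d, inside those of radius 1/2 · d whose overlap is
    -- bounded.
    · set S : Set ℕ := {j | j ∈ (W m).index ∧ y ∈ Metric.ball ((W m).center j)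
        (1 / 2 * Metric.infDist ((W m).center j) (levelSet A b f m)ᶜ)} with hS
      have hcard : (S.encard : ℝ≥0∞) ≤ (1024 ^ n : ℕ) := by
        have := encard_whitney_le (W m).pairwiseDisjoint y
        rwa [← ENat.toENNReal_le, ENat.toENNReal_coe] at this
      have hval : ∀ j ∈ (W m).index, ‖(W (m + 1)).piece (W m) f j y‖ₑ ≤ B * 2 ^ m := by
        intro j hj
        rw [hB, ← ofReal_two_zpow, ← ENNReal.ofReal_mul (by positivity), ← ofReal_norm]
        exact ENNReal.ofReal_le_ofReal
          (norm_piece_le_of_levelSet hA hb hK hc hC hf hne W hj y)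
      calc ∑' j : (W m).index, ‖(W (m + 1)).piece (W m) f j y‖ₑ
          = ∑' j, (W m).index.indicator (fun j => ‖(W (m + 1)).piece (W m) f j y‖ₑ) j :=
            tsum_subtype (W m).index (fun j => ‖(W (m + 1)).piece (W m) f j y‖ₑ)
        _ ≤ ∑' j, S.indicator (fun _ => B * 2 ^ m) j := by
            refine ENNReal.tsum_le_tsum fun j => ?_
            by_cases hj : j ∈ (W m).index
            · rw [Set.indicator_of_mem hj]
              by_cases hjS : j ∈ S
              · rw [Set.indicator_of_mem hjS]
                exact hval j hj
              · have h0 : (W (m + 1)).piece (W m) f j y = 0 := by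
                  refine image_eq_zero_of_notMem_tsupport fun h => hjS ⟨hj, ?_⟩
                  have h1 := (W (m + 1)).tsupport_piece_subset (W m) (hO _) (hne _) (hO _) (hne _)
                    hsub f hj h
                  have h2 := infDist_compl_pos (hO m) (hne m) ((W m).center_mem j hj)
                  exact Metric.ball_subset_ball (by linarith) h1
                rw [h0]; simp
            · rw [Set.indicator_of_notMem hj]; positivity
        _ = S.encard * (B * 2 ^ m) := by rw [← tsum_subtype, ENNReal.tsum_set_const]
        _ ≤ (1024 ^ n : ℕ) * (B * 2 ^ m) := by gcongr
        _ = _ := by rw [mul_assoc]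
    · refine le_of_eq ?_
      rw [mul_zero, ENNReal.tsum_eq_zero]
      intro j
      rw [(W (m + 1)).piece_apply_eq_zero (W m) (hO _) (hne _) (hO _) (hne _) hsub f j hy,
        enorm_zero]
  calc _ ≤ ∑' m : ℤ, (1024 ^ n : ℕ) * B *
        (if (2 : ℝ≥0∞) ^ m < grandMaximal A b f y then (2 : ℝ≥0∞) ^ m else 0) :=
        ENNReal.tsum_le_tsum hm
    _ ≤ (1024 ^ n : ℕ) * B * (D * grandMaximal A b f y) := by
        rw [ENNReal.tsum_mul_left]
        gcongr
        exact hD _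
    _ = _ := by ring

/-- Once 2^m exceeds Mf(y), the point y has left O^(m), so the sequence is eventually constant. -/
theorem tendsto_smoothing_atTop (hne : ∀ m, (levelSet A b f m)ᶜ.Nonempty)
    (W : ∀ m, WhitneyPartition K c (levelSet A b f m)) {y : E}
    (hy : grandMaximal A b f y ≠ ⊤) :
    Tendsto (fun m : ℤ => (W m).smoothing f y) atTop (𝓝 (f y)) := by
  refine tendsto_const_nhds.congr' ?_
  obtain ⟨k, hk⟩ := ENNReal.exists_nat_gt hy
  filter_upwards [eventually_ge_atTop (k : ℤ)] with m hm
  refine ((W m).smoothing_apply_of_notMem (isOpen_levelSet f m) (hne m) f ?_).symm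
  have h2 : (k : ℝ≥0∞) ≤ 2 ^ m := by
    calc (k : ℝ≥0∞) ≤ (2 : ℝ≥0∞) ^ k := by exact_mod_cast Nat.lt_two_pow_self.le
      _ = (2 : ℝ≥0∞) ^ (k : ℤ) := (zpow_natCast _ _).symm
      _ ≤ 2 ^ m := ENNReal.zpow_le_of_le (by norm_num) hm
  exact not_lt.mpr (hk.le.trans h2)

theorem tendsto_smoothing_atBot (hA : 0 < A) (hb : 1 < b) (hK : 0 < K)
    (hc : 0 < c) (hC : 0 < C)
    (hf : ∀ x, ‖f x‖ₑ ≤ ENNReal.ofReal C * grandMaximal A b f x)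
    (hne : ∀ m, (levelSet A b f m)ᶜ.Nonempty)
    (W : ∀ m, WhitneyPartition K c (levelSet A b f m)) (y : E) :
    Tendsto (fun m : ℤ => (W m).smoothing f y) atBot (𝓝 0) := by
  set M : ℝ := C + K / (A * c) with hM
  have hb0 : Tendsto (fun m : ℤ => M * (2 : ℝ) ^ m) atBot (𝓝 0) := by
    have : Tendsto (fun m : ℤ => (2 : ℝ) ^ m) atBot (𝓝 0) := by
      refine ((tendsto_rpow_atBot_of_base_gt_one 2 (by norm_num)).comp
        (tendsto_intCast_atBot_iff.mpr tendsto_id)).congr fun m => ?_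
      simp [Real.rpow_intCast]
    simpa using this.const_mul M
  refine squeeze_zero_norm (fun m => ?_) hb0
  have hKc : 0 < K / (A * c) := by positivity
  refine (W m).norm_smoothing_le (isOpen_levelSet f m) (hne m) (fun y hy => ?_)
    (fun i hi => ?_) y
  · have h1 : ‖f y‖ₑ ≤ ENNReal.ofReal (C * 2 ^ m) := by
      rw [ENNReal.ofReal_mul hC.le, ofReal_two_zpow]
      exact (hf y).trans (mul_le_mul' le_rfl (not_lt.mp hy))
    rw [← ofReal_norm, ENNReal.ofReal_le_ofReal_iff (by positivity)] at h1
    refine h1.trans ?_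
    gcongr
    linarith
  · refine (norm_avg_le_of_levelSet hA hb hK hc hne W hi).trans ?_
    gcongr
    linarith

/-- At points where the grand maximal function is finite, the pieces sum up to `f`. -/
theorem hasSum_piece_of_grandMaximal_ne_top (hA : 0 < A) (hb : 1 < b) (hK : 0 < K)
    (hc : 0 < c) (hC : 0 < C) (hfl : LocallyIntegrable f volume)
    (hf : ∀ x, ‖f x‖ₑ ≤ ENNReal.ofReal C * grandMaximal A b f x)
    (hne : ∀ m, (levelSet A b f m)ᶜ.Nonempty)
    (W : ∀ m, WhitneyPartition K c (levelSet A b f m)) {y : E}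
    (hy : grandMaximal A b f y ≠ ⊤) :
    HasSum (fun i : Σ m : ℤ, (W m).index => (W (i.1 + 1)).piece (W i.1) f i.2 y) (f y) := by
  obtain ⟨D, _, hDt, hD⟩ := exists_tsum_zpow_lt_le_one
  have hsum : Summable fun i : Σ m : ℤ, (W m).index =>
      (W (i.1 + 1)).piece (W i.1) f i.2 y := by
    have hle := tsum_enorm_piece_le hA hb hK hc hC hf hne W hD y
    refine Summable.of_norm (tsum_enorm_ne_top_iff_summable_norm.mp (ne_top_of_le_ne_top ?_ hle))
    exact ENNReal.mul_ne_top (ENNReal.mul_ne_top (ENNReal.mul_ne_top (ENNReal.natCast_ne_top _)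
      ENNReal.ofReal_ne_top) hDt) hy
  have hlevel : ∀ m : ℤ, HasSum (fun j : (W m).index => (W (m + 1)).piece (W m) f j y)
      ((W (m + 1)).smoothing f y - (W m).smoothing f y) := fun m =>
    (W (m + 1)).hasSum_piece (W m) (isOpen_levelSet f _) (hne _) (isOpen_levelSet f _) (hne _)
      (levelSet_antitone f (by omega)) hfl y
  have hs := hsum.hasSum
  have h1 := hs.sigma hlevel
  have h2 := eq_of_hasSum_int_telescoping (g := fun m => (W m).smoothing f y) h1
    (tendsto_smoothing_atTop hne W hy)
    (tendsto_smoothing_atBot hA hb hK hc hC hf hne W y)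
  rw [h2] at hs
  exact hs

/-- The measures of the superlevel sets are summable against the levels. -/
theorem tsum_zpow_mul_volume_levelSet_le {D : ℝ≥0∞}
    (hD : ∀ a : ℝ≥0∞, ∑' m : ℤ, (if (2 : ℝ≥0∞) ^ m < a then (2 : ℝ≥0∞) ^ m else 0) ≤ D * a)
    (f : E → 𝕜) :
    ∑' m : ℤ, (2 : ℝ≥0∞) ^ m * volume (levelSet A b f m) ≤ D * hardyNorm A b f := by
  have hO : ∀ m, MeasurableSet (levelSet A b f m) := fun m => (isOpen_levelSet f m).measurableSet
  calc ∑' m : ℤ, (2 : ℝ≥0∞) ^ m * volume (levelSet A b f m)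
      = ∑' m : ℤ, ∫⁻ x, (levelSet A b f m).indicator (fun _ => (2 : ℝ≥0∞) ^ m) x := by
        congr 1 with m
        rw [lintegral_indicator_const (hO m)]
    _ = ∫⁻ x, ∑' m : ℤ, (levelSet A b f m).indicator (fun _ => (2 : ℝ≥0∞) ^ m) x :=
        (lintegral_tsum fun m => (measurable_const.indicator (hO m)).aemeasurable).symm
    _ ≤ ∫⁻ x, D * grandMaximal A b f x := by
        refine lintegral_mono fun x => ?_
        refine le_trans (ENNReal.tsum_le_tsum fun m => ?_) (hD _)
        simp only [Set.indicator_apply, levelSet, Set.mem_ofPred_eq]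
        rfl
    _ = D * hardyNorm A b f := lintegral_const_mul _ (measurable_grandMaximal f)

theorem tsum_coeff_le {C' : ℝ} (hC' : 0 < C') (hne : ∀ m, (levelSet A b f m)ᶜ.Nonempty)
    (W : ∀ m, WhitneyPartition K c (levelSet A b f m)) {D : ℝ≥0∞}
    (hD : ∀ a : ℝ≥0∞, ∑' m : ℤ, (if (2 : ℝ≥0∞) ^ m < a then (2 : ℝ≥0∞) ^ m else 0) ≤ D * a) :
    ∑' i : Σ m : ℤ, (W m).index, ENNReal.ofReal (coeff A b f C' i.1 ((W i.1).center i.2)) ≤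
      ENNReal.ofReal (C' * 128 ^ n / unitVol n) * D * hardyNorm A b f := by
  have hO : ∀ m, IsOpen (levelSet A b f m) := fun m => isOpen_levelSet f m
  have hv := unitVol_pos (n := n)
  rw [ENNReal.tsum_sigma', mul_assoc]
  refine le_trans (ENNReal.tsum_le_tsum fun m => ?_) (le_trans (ENNReal.tsum_mul_left).le
    (mul_le_mul' le_rfl (tsum_zpow_mul_volume_levelSet_le hD f)))
  -- The shrunken balls are disjoint and contained in O^(m), and the volume of each is a fixed
  -- multiple of d^n.
  have hball : ∑' j : (W m).index, volume (Metric.ball ((W m).center j)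
      (Metric.infDist ((W m).center j) (levelSet A b f m)ᶜ / 128)) ≤
      volume (levelSet A b f m) := by
    have hd : Pairwise (Function.onFun Disjoint fun j : (W m).index =>
      Metric.ball ((W m).center j) (Metric.infDist ((W m).center j) (levelSet A b f m)ᶜ / 128)) :=
      (W m).pairwiseDisjoint.subtype _ _
    rw [← measure_iUnion hd fun _ => measurableSet_ball]
    refine measure_mono (Set.iUnion_subset fun j y hy => mem_of_infDist_compl_pos ?_)
    have h1 : Metric.infDist ((W m).center j) (levelSet A b f m)ᶜ ≤
      Metric.infDist y (levelSet A b f m)ᶜ + dist ((W m).center j) y :=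
      Metric.infDist_le_infDist_add_dist
    have h2 := infDist_compl_pos (hO m) (hne m) ((W m).center_mem j j.2)
    rw [Metric.mem_ball, dist_comm] at hy
    linarith
  refine le_trans (le_of_eq ?_) (mul_le_mul' le_rfl (mul_le_mul' le_rfl hball))
  rw [← ENNReal.tsum_mul_left, ← ENNReal.tsum_mul_left]
  congr 1 with j
  have h2 := infDist_compl_pos (hO m) (hne m) ((W m).center_mem j j.2)
  rw [volume_ball_eq _ (by linarith), ← ofReal_two_zpow, ← ENNReal.ofReal_mul (by positivity),
    ← ENNReal.ofReal_mul (by positivity), coeff, distCompl]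
  congr 1
  rw [div_pow]
  field_simp

end Decomposition

/-! ### Integrability of powers of the grand maximal function. -/

/-- A Vitali-type covering estimate. -/
theorem volume_le_of_forall_exists_closedBall (hn : 1 ≤ n) {h : E → ℝ≥0∞} {S : Set E} {q : ℝ≥0∞}
    (hq : q * ∫⁻ x, h x ≠ ⊤)
    (hS : ∀ x ∈ S, ∃ r : ℝ, 0 < r ∧
      ENNReal.ofReal (r ^ n) ≤ q * ∫⁻ z in Metric.closedBall x r, h z) :
    volume S ≤ ENNReal.ofReal (unitVol n * 5 ^ n) * (q * ∫⁻ x, h x) := by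
  have hv := unitVol_pos (n := n)
  choose! r hr0 hr using hS
  -- Vitali's lemma needs bounded radii; for r ≥ 1 and n ≥ 1 one has r ≤ r^n, which the finite total
  -- integral controls.
  have hbound : ∀ x ∈ S, r x ≤ max 1 (q * ∫⁻ x, h x).toReal := by
    intro x hx
    rcases le_total (r x) 1 with h1 | h1
    · exact h1.trans (le_max_left _ _)
    · have h2 : ENNReal.ofReal (r x ^ n) ≤ q * ∫⁻ x, h x :=
        (hr x hx).trans (mul_le_mul' le_rfl (setLIntegral_le_lintegral _ _))
      have h3 : r x ^ n ≤ (q * ∫⁻ x, h x).toReal := (ENNReal.ofReal_le_iff_le_toReal hq).mp h2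
      exact ((le_self_pow₀ h1 (by omega)).trans h3).trans (le_max_right _ _)
  obtain ⟨u, huS, hdisj, hcov⟩ := Vitali.exists_disjoint_subfamily_covering_enlargement_closedBall
    S (fun x : E => x) r _ hbound 5 (by norm_num)
  have hcount : u.Countable := hdisj.countable_of_nonempty_interior fun x hx =>
    ⟨x, Metric.ball_subset_interior_closedBall (Metric.mem_ball_self (hr0 x (huS hx)))⟩
  have hsub : S ⊆ ⋃ x ∈ u, Metric.closedBall x (5 * r x) := by
    intro x hx
    obtain ⟨y, hy, hxy⟩ := hcov x hx
    exact Set.mem_biUnion hy (hxy (Metric.mem_closedBall_self (hr0 x hx).le))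
  have : Countable u := hcount
  calc volume S ≤ volume (⋃ x ∈ u, Metric.closedBall x (5 * r x)) := measure_mono hsub
    _ ≤ ∑' x : u, volume (Metric.closedBall (x : E) (5 * r x)) := measure_biUnion_le _ hcount _
    _ ≤ ∑' x : u, ENNReal.ofReal (unitVol n * 5 ^ n) *
          (q * ∫⁻ z in Metric.closedBall (x : E) (r x), h z) := by
        refine ENNReal.tsum_le_tsum fun x => ?_
        have hx := hr0 x (huS x.2)
        rw [volume_closedBall_eq _ (by positivity), mul_pow, ← mul_assoc,
          ENNReal.ofReal_mul (by positivity)]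
        exact mul_le_mul' le_rfl (hr x (huS x.2))
    _ = ENNReal.ofReal (unitVol n * 5 ^ n) *
          (q * ∫⁻ z in ⋃ x ∈ u, Metric.closedBall (x : E) (r x), h z) := by
        rw [ENNReal.tsum_mul_left, ENNReal.tsum_mul_left,
          lintegral_biUnion hcount (fun _ _ => Metric.isClosed_closedBall.measurableSet) hdisj]
    _ ≤ _ := mul_le_mul' le_rfl (mul_le_mul' le_rfl (setLIntegral_le_lintegral _ _))

/-- φ vanishes at a unit vector, which exists since n ≥ 1, and the mean value inequality applies
over a distance of at most 2. -/
theorem norm_testClass_le (hn : 1 ≤ n) {A : ℝ} (hA : 0 < A) {φ : E → 𝕜}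
    (hφ : φ ∈ testClass 𝕜 n A) (u : E) : ‖φ u‖ ≤ 2 * A := by
  by_cases hu : u ∈ Metric.ball (0 : E) 1
  · have : Nonempty (Fin n) := ⟨⟨0, hn⟩⟩
    obtain ⟨e, he⟩ := exists_norm_eq E (zero_le_one (α := ℝ))
    have h0 : φ e = 0 := by
      refine image_eq_zero_of_notMem_tsupport fun h => ?_
      have := hφ.2.1 h
      rw [mem_ball_zero_iff, he] at this
      exact lt_irrefl _ this
    have h1 := convex_univ.norm_image_sub_le_of_norm_fderiv_le (𝕜 := ℝ) (f := φ) (C := A)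
      (fun x _ => (hφ.1.differentiable (by simp)).differentiableAt) (fun x _ => hφ.2.2 x)
      (Set.mem_univ e) (Set.mem_univ u)
    rw [h0, sub_zero] at h1
    rw [mem_ball_zero_iff] at hu
    have h2 := norm_sub_le u e
    nlinarith
  · rw [image_eq_zero_of_notMem_tsupport fun h => hu (hφ.2.1 h), norm_zero]
    positivity

theorem enorm_convolution_dilate_le (hn : 1 ≤ n) {A : ℝ} (hA : 0 < A) {φ : E → 𝕜}
    (hφ : φ ∈ testClass 𝕜 n A) {t : ℝ} (ht : 0 < t) (f : E → 𝕜) (y : E) :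
    ‖convolution f (dilate φ t) (ContinuousLinearMap.mul 𝕜 𝕜) volume y‖ₑ ≤
      ENNReal.ofReal (2 * A / t ^ n) * ∫⁻ z in Metric.closedBall y t, ‖f z‖ₑ := by
  rw [convolution_mul_dilate_apply, ← lintegral_const_mul' _ _ ENNReal.ofReal_ne_top,
    ← lintegral_indicator Metric.isClosed_closedBall.measurableSet]
  refine (enorm_integral_le_lintegral_enorm _).trans (lintegral_mono fun z => ?_)
  by_cases hz : z ∈ Metric.closedBall y t
  · rw [Set.indicator_of_mem hz, enorm_mul, mul_comm, enorm_smul]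
    gcongr
    rw [Real.enorm_eq_ofReal (by positivity), ← ofReal_norm,
      ← ENNReal.ofReal_mul (by positivity), div_eq_inv_mul]
    refine ENNReal.ofReal_le_ofReal ?_
    gcongr
    exact norm_testClass_le hn hA hφ _
  · rw [Set.indicator_of_notMem hz]
    have : φ (t⁻¹ • (y - z)) = 0 := by
      refine image_eq_zero_of_notMem_tsupport fun h => hz ?_
      have := hφ.2.1 h
      rw [mem_ball_zero_iff, norm_smul, norm_inv, Real.norm_of_nonneg ht.le,
        inv_mul_lt_iff₀ ht, mul_one, ← dist_eq_norm] at this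
      rw [Metric.mem_closedBall, dist_comm]
      exact this.le
    simp [this]

/-- A weak-type estimate for the grand maximal function, keeping only the large values of `f`. -/
theorem volume_lt_grandMaximal_le (hn : 1 ≤ n) {A b : ℝ} (hA : 0 < A) (hb : 1 < b) (f : E → 𝕜)
    {s : ℝ} (hs : 0 < s) :
    volume {x | ENNReal.ofReal s < grandMaximal A b f x} ≤
      ENNReal.ofReal (unitVol n * 5 ^ n) * (ENNReal.ofReal ((b + 1) ^ n * (4 * A) / s) *
        ∫⁻ x, if ENNReal.ofReal s < ENNReal.ofReal (4 * A * unitVol n) * ‖f x‖ₑ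
          then ‖f x‖ₑ else 0) := by
  have hv := unitVol_pos (n := n)
  set h : E → ℝ≥0∞ := fun x => if ENNReal.ofReal s < ENNReal.ofReal (4 * A * unitVol n) * ‖f x‖ₑ
    then ‖f x‖ₑ else 0 with hh
  rcases eq_or_ne (∫⁻ x, h x) ⊤ with htop | htop
  · rw [htop, ENNReal.mul_top, ENNReal.mul_top]
    · exact le_top
    all_goals
      rw [Ne, ENNReal.ofReal_eq_zero, not_le]
      positivity
  refine volume_le_of_forall_exists_closedBall hn (ENNReal.mul_ne_top ENNReal.ofReal_ne_top htop)
    fun x hx => ?_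
  simp only [Set.mem_ofPred_eq, grandMaximal, lt_iSup_iff] at hx
  obtain ⟨φ, hφ, t, ht, y, hy, hlt⟩ := hx
  refine ⟨(b + 1) * t, by positivity, ?_⟩
  -- The threshold is chosen so that the small part of f contributes exactly s/2 to the bound for
  -- the convolution, leaving s/2 to the large part h.
  have hpt : ∀ z, ‖f z‖ₑ ≤ h z + ENNReal.ofReal (s / (4 * A * unitVol n)) := by
    intro z
    simp only [hh]
    split_ifs with hz
    · exact le_self_add
    · rw [zero_add, ENNReal.ofReal_div_of_pos (by positivity), ENNReal.le_div_iff_mul_le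
        (Or.inl (by rw [Ne, ENNReal.ofReal_eq_zero, not_le]; positivity))
        (Or.inl ENNReal.ofReal_ne_top), mul_comm]
      exact not_lt.mp hz
  have h1 : ENNReal.ofReal (s / 2) + ENNReal.ofReal (s / 2) ≤
      ENNReal.ofReal (2 * A / t ^ n) * (∫⁻ z in Metric.closedBall y t, h z) +
        ENNReal.ofReal (s / 2) := by
    rw [← ENNReal.ofReal_add (by positivity) (by positivity), add_halves]
    calc ENNReal.ofReal s ≤ ENNReal.ofReal (2 * A / t ^ n) *
          ∫⁻ z in Metric.closedBall y t, ‖f z‖ₑ :=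
          hlt.le.trans (enorm_convolution_dilate_le hn hA hφ ht f y)
      _ ≤ ENNReal.ofReal (2 * A / t ^ n) * ∫⁻ z in Metric.closedBall y t,
          (h z + ENNReal.ofReal (s / (4 * A * unitVol n))) := by
          gcongr with z
          exact hpt z
      _ = _ := by
          rw [lintegral_add_right _ measurable_const, setLIntegral_const, mul_add,
            volume_closedBall_eq y ht, ← ENNReal.ofReal_mul (by positivity),
            ← ENNReal.ofReal_mul (by positivity)]
          congr 2
          field_simp
          ring
  have h2 := (ENNReal.add_le_add_iff_right ENNReal.ofReal_ne_top).mp h1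
  have h3 : Metric.closedBall y t ⊆ Metric.closedBall x ((b + 1) * t) :=
    Metric.closedBall_subset_closedBall' (by linarith)
  calc ENNReal.ofReal (((b + 1) * t) ^ n)
      = ENNReal.ofReal ((b + 1) ^ n * t ^ n * 2 / s) * ENNReal.ofReal (s / 2) := by
        rw [← ENNReal.ofReal_mul (by positivity), mul_pow]
        congr 1
        field_simp
    _ ≤ ENNReal.ofReal ((b + 1) ^ n * t ^ n * 2 / s) *
        (ENNReal.ofReal (2 * A / t ^ n) * ∫⁻ z in Metric.closedBall x ((b + 1) * t), h z) :=
        mul_le_mul' le_rfl (h2.trans (mul_le_mul' le_rfl (lintegral_mono_set h3)))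
    _ = _ := by
        rw [← mul_assoc, ← ENNReal.ofReal_mul (by positivity)]
        congr 2
        field_simp
        ring

/-- The grand maximal function is bounded on `L^p`, `1 < p < ∞`. -/
theorem lintegral_grandMaximal_rpow_lt_top (hn : 1 ≤ n) {A b : ℝ} (hA : 0 < A) (hb : 1 < b)
    {f : E → 𝕜} (hfm : AEStronglyMeasurable f) (hfin : ∀ᵐ x, grandMaximal A b f x ≠ ⊤) {p : ℝ}
    (hp : 1 < p) (hfp : ∫⁻ x, ‖f x‖ₑ ^ p < ⊤) : ∫⁻ x, grandMaximal A b f x ^ p < ⊤ := by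
  have hv := unitVol_pos (n := n)
  have hp0 : 0 < p := by linarith
  obtain ⟨D, _, hDt, hD⟩ := exists_tsum_zpow_lt_le (show 0 < p - 1 by linarith)
  set κ : ℝ≥0∞ := ENNReal.ofReal (4 * A * unitVol n) with hκ
  set Q : ℝ≥0∞ := (2 : ℝ≥0∞) ^ p * (ENNReal.ofReal (unitVol n * 5 ^ n) *
    ENNReal.ofReal ((b + 1) ^ n * (4 * A))) with hQ
  have hQt : Q ≠ ⊤ := ENNReal.mul_ne_top (ENNReal.rpow_ne_top_of_nonneg hp0.le (by simp))
    (ENNReal.mul_ne_top ENNReal.ofReal_ne_top ENNReal.ofReal_ne_top)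
  have hmeas : ∀ m : ℤ, MeasurableSet (levelSet A b f m) := fun m =>
    (isOpen_levelSet f m).measurableSet
  have h2 : ∀ m : ℤ, (2 : ℝ≥0∞) ^ m ≠ 0 := fun m => (ENNReal.zpow_pos (by simp) (by simp) m).ne'
  have h2t : ∀ m : ℤ, (2 : ℝ≥0∞) ^ m ≠ ⊤ := fun m => by
    rw [← ofReal_two_zpow]; exact ENNReal.ofReal_ne_top
  -- Marcinkiewicz interpolation in dyadic form: the weak-type bound loses one factor 2^m, and
  -- summing the remaining (2^m)^(p-1) over 2^m < κ|f(x)| returns |f(x)|^(p-1), since p > 1.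
  have hlevel : ∀ m : ℤ, ((2 : ℝ≥0∞) ^ (m + 1)) ^ p * volume (levelSet A b f m) ≤
      Q * ∫⁻ x, (if (2 : ℝ≥0∞) ^ m < κ * ‖f x‖ₑ then ((2 : ℝ≥0∞) ^ m) ^ (p - 1) else 0) *
        ‖f x‖ₑ := by
    intro m
    have hw := volume_lt_grandMaximal_le hn hA hb f (s := (2 : ℝ) ^ m) (by positivity)
    rw [ofReal_two_zpow, ENNReal.ofReal_div_of_pos (by positivity), ofReal_two_zpow] at hw
    have hpow : ((2 : ℝ≥0∞) ^ (m + 1)) ^ p =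
        (2 : ℝ≥0∞) ^ p * (((2 : ℝ≥0∞) ^ m) ^ (p - 1) * 2 ^ m) := by
      rw [ENNReal.zpow_add (by simp) (by simp), zpow_one, ENNReal.mul_rpow_of_nonneg _ _ hp0.le,
        mul_comm]
      congr 1
      nth_rw 3 [← ENNReal.rpow_one ((2 : ℝ≥0∞) ^ m)]
      rw [← ENNReal.rpow_add _ _ (h2 m) (h2t m), sub_add_cancel]
    have hint : ∫⁻ x, (if (2 : ℝ≥0∞) ^ m < κ * ‖f x‖ₑ then ((2 : ℝ≥0∞) ^ m) ^ (p - 1) else 0) *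
        ‖f x‖ₑ = ((2 : ℝ≥0∞) ^ m) ^ (p - 1) *
          ∫⁻ x, if (2 : ℝ≥0∞) ^ m < κ * ‖f x‖ₑ then ‖f x‖ₑ else 0 := by
      rw [← lintegral_const_mul' _ _ (ENNReal.rpow_ne_top_of_nonneg (by linarith) (h2t m))]
      congr 1 with x
      split_ifs <;> simp
    rw [hpow, hint]
    refine (mul_le_mul' le_rfl hw).trans (le_of_eq ?_)
    rw [hQ, ENNReal.div_eq_inv_mul]
    calc _ = ((2 : ℝ≥0∞) ^ m * ((2 : ℝ≥0∞) ^ m)⁻¹) * ((2 : ℝ≥0∞) ^ p *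
          (ENNReal.ofReal (unitVol n * 5 ^ n) * ENNReal.ofReal ((b + 1) ^ n * (4 * A))) *
          (((2 : ℝ≥0∞) ^ m) ^ (p - 1) *
            ∫⁻ x, if (2 : ℝ≥0∞) ^ m < κ * ‖f x‖ₑ then ‖f x‖ₑ else 0)) := by ring
      _ = _ := by rw [ENNReal.mul_inv_cancel (h2 m) (h2t m), one_mul]
  have hpt : ∀ᵐ x, grandMaximal A b f x ^ p ≤
      ∑' m : ℤ, (levelSet A b f m).indicator (fun _ => ((2 : ℝ≥0∞) ^ (m + 1)) ^ p) x := by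
    filter_upwards [hfin] with x hx
    rcases eq_or_ne (grandMaximal A b f x) 0 with h0 | h0
    · rw [h0, ENNReal.zero_rpow_of_pos hp0]; exact zero_le
    obtain ⟨M, hM1, hM2⟩ := ENNReal.exists_mem_Ioc_zpow h0 hx (y := 2) (by norm_num) (by simp)
    refine le_trans ?_ (ENNReal.le_tsum M)
    rw [Set.indicator_of_mem (show x ∈ levelSet A b f M from hM1)]
    gcongr
  have hf1 : AEMeasurable fun x => ‖f x‖ₑ := hfm.enorm
  calc ∫⁻ x, grandMaximal A b f x ^ p
      ≤ ∫⁻ x, ∑' m : ℤ, (levelSet A b f m).indicator (fun _ => ((2 : ℝ≥0∞) ^ (m + 1)) ^ p) x :=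
        lintegral_mono_ae hpt
    _ = ∑' m : ℤ, ((2 : ℝ≥0∞) ^ (m + 1)) ^ p * volume (levelSet A b f m) := by
        rw [lintegral_tsum fun m => (measurable_const.indicator (hmeas m)).aemeasurable]
        congr 1 with m
        rw [lintegral_indicator_const (hmeas m)]
    _ ≤ ∑' m : ℤ, Q * ∫⁻ x, (if (2 : ℝ≥0∞) ^ m < κ * ‖f x‖ₑ
          then ((2 : ℝ≥0∞) ^ m) ^ (p - 1) else 0) * ‖f x‖ₑ := ENNReal.tsum_le_tsum hlevel
    _ = Q * ∫⁻ x, (∑' m : ℤ, if (2 : ℝ≥0∞) ^ m < κ * ‖f x‖ₑ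
          then ((2 : ℝ≥0∞) ^ m) ^ (p - 1) else 0) * ‖f x‖ₑ := by
        rw [ENNReal.tsum_mul_left]
        simp only [← ENNReal.tsum_mul_right]
        rw [lintegral_tsum fun m => ?_]
        refine AEMeasurable.mul ?_ hf1
        have hg : Measurable fun a : ℝ≥0∞ =>
            if (2 : ℝ≥0∞) ^ m < κ * a then ((2 : ℝ≥0∞) ^ m) ^ (p - 1) else 0 :=
          Measurable.ite (measurableSet_lt measurable_const (measurable_id.const_mul κ))
            measurable_const measurable_const
        exact hg.comp_aemeasurable hf1
    _ ≤ Q * ∫⁻ x, D * κ ^ (p - 1) * ‖f x‖ₑ ^ p := by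
        refine mul_le_mul' le_rfl (lintegral_mono fun x => ?_)
        refine (mul_le_mul' (hD _) le_rfl).trans (le_of_eq ?_)
        rw [ENNReal.mul_rpow_of_nonneg _ _ (by linarith), ← mul_assoc, mul_assoc (D * _)]
        congr 1
        nth_rw 2 [← ENNReal.rpow_one ‖f x‖ₑ]
        rw [← ENNReal.rpow_add_of_nonneg _ _ (by linarith) zero_le_one, sub_add_cancel]
    _ < ⊤ := by
        have hc : D * κ ^ (p - 1) ≠ ⊤ := ENNReal.mul_ne_top hDt
          (ENNReal.rpow_ne_top_of_nonneg (by linarith) ENNReal.ofReal_ne_top)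
        rw [lintegral_const_mul' _ _ hc]
        exact ENNReal.mul_lt_top hQt.lt_top (ENNReal.mul_lt_top hc.lt_top hfp)

/-! ### Norm convergence, normalization to atoms, and changes on null sets. -/

/-- Dominated unconditional convergence of series in `L^p`. -/
theorem tendsto_eLpNorm_sub_sum {α ι : Type*} [MeasurableSpace α] {μ : Measure α} [Countable ι]
    {F : ι → α → 𝕜} {f : α → 𝕜} {g : α → ℝ≥0∞} {p : ℝ≥0∞} (hp : 1 ≤ p) (hpt : p ≠ ⊤)
    (hF : ∀ i, AEStronglyMeasurable (F i) μ) (hf : AEStronglyMeasurable f μ)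
    (hsum : ∀ᵐ x ∂μ, HasSum (fun i => F i x) (f x)) {C₁ C₂ : ℝ≥0∞} (hC₁ : C₁ ≠ ⊤) (hC₂ : C₂ ≠ ⊤)
    (hfg : ∀ x, ‖f x‖ₑ ≤ C₁ * g x) (hFg : ∀ x, ∑' i, ‖F i x‖ₑ ≤ C₂ * g x)
    (hg : ∫⁻ x, g x ^ p.toReal ∂μ ≠ ⊤) :
    Tendsto (fun S : Finset ι => eLpNorm (fun x => f x - ∑ i ∈ S, F i x) p μ) atTop (𝓝 0) := by
  have hp0 : p ≠ 0 := (zero_lt_one.trans_le hp).ne'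
  have hpr : 0 < p.toReal := ENNReal.toReal_pos hp0 hpt
  have hlim : Tendsto (fun S : Finset ι => ∫⁻ x, ‖f x - ∑ i ∈ S, F i x‖ₑ ^ p.toReal ∂μ) atTop
      (𝓝 (∫⁻ _, 0 ∂μ)) := by
    refine tendsto_lintegral_filter_of_dominated_convergence'
      (fun x => ((C₁ + C₂) * g x) ^ p.toReal) (Eventually.of_forall fun S => ?_)
      (Eventually.of_forall fun S => Eventually.of_forall fun x => ?_) ?_ ?_
    · exact ((hf.sub (Finset.aestronglyMeasurable_fun_sum S fun i _ => hF i)).enorm).pow_const _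
    · gcongr
      refine enorm_sub_le.trans ?_
      rw [add_mul]
      refine add_le_add (hfg x) (((enorm_sum_le _ _).trans (ENNReal.sum_le_tsum S)).trans (hFg x))
    · simp only [ENNReal.mul_rpow_of_nonneg _ _ hpr.le]
      have hC : (C₁ + C₂) ^ p.toReal ≠ ⊤ :=
        ENNReal.rpow_ne_top_of_nonneg hpr.le (ENNReal.add_ne_top.mpr ⟨hC₁, hC₂⟩)
      rw [lintegral_const_mul' _ _ hC]
      exact ENNReal.mul_ne_top hC hg
    · filter_upwards [hsum] with x hx
      have h1 : Tendsto (fun S : Finset ι => ‖f x - ∑ i ∈ S, F i x‖ₑ) atTop (𝓝 0) := by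
        have := (tendsto_const_nhds (x := f x)).sub hx
        simpa using this.enorm
      have h2 := (ENNReal.continuous_rpow_const (y := p.toReal)).tendsto 0 |>.comp h1
      rwa [ENNReal.zero_rpow_of_pos hpr] at h2
  rw [lintegral_zero] at hlim
  have h3 := (ENNReal.continuous_rpow_const (y := 1 / p.toReal)).tendsto 0 |>.comp hlim
  rw [ENNReal.zero_rpow_of_pos (by positivity)] at h3
  refine h3.congr fun S => ?_
  rw [eLpNorm_eq_lintegral_rpow_enorm_toReal hp0 hpt]
  rfl

theorem isAtom_zero : IsAtom ⊤ (0 : E → 𝕜) := by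
  refine ⟨aestronglyMeasurable_zero, 0, 1, one_pos, by simp, ?_, by simp⟩
  rw [eLpNorm_zero]
  exact zero_le

theorem isAtom_inv_smul_of_norm_le {B : ℝ} (hB : 0 < B) {s d : ℝ} (hs : 0 < s) (hd : 0 < d)
    {β : E → 𝕜} {x : E} (hm : AEStronglyMeasurable β)
    (hsupp : tsupport β ⊆ Metric.ball x (3 / 8 * d)) (hβ : ∀ y, ‖β y‖ ≤ B * s)
    (hint : ∫ y, β y = 0) :
    IsAtom ⊤ (fun y => (B * unitVol n * s * d ^ n)⁻¹ • β y) := by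
  have hv := unitVol_pos (n := n)
  have hsub : tsupport (fun y => (B * unitVol n * s * d ^ n)⁻¹ • β y) ⊆
      Metric.ball x (3 / 8 * d) :=
    (closure_mono fun y (hy : _ ≠ _) (h : β y = 0) => hy (by simp [h])).trans hsupp
  refine ⟨hm.const_smul _, x, 3 / 8 * d, by positivity, hsub, ?_, ?_⟩
  · rw [eLpNorm_exponent_top, ENNReal.inv_top, ENNReal.toReal_zero, add_zero,
      ENNReal.rpow_neg_one, volume_ball_eq x (by positivity),
      ← ENNReal.ofReal_inv_of_pos (by positivity)]
    refine eLpNormEssSup_le_of_ae_enorm_bound (Eventually.of_forall fun y => ?_)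
    rw [← ofReal_norm]
    refine ENNReal.ofReal_le_ofReal ?_
    rw [norm_smul, norm_inv, Real.norm_of_nonneg (by positivity)]
    calc (B * unitVol n * s * d ^ n)⁻¹ * ‖β y‖ ≤ (B * unitVol n * s * d ^ n)⁻¹ * (B * s) := by
          gcongr
          exact hβ y
      _ = (unitVol n * d ^ n)⁻¹ := by field_simp
      -- The coefficient is normalized by the ball of radius d; the supporting ball is smaller, so
      -- its inverse volume is larger.
      _ ≤ (unitVol n * (3 / 8 * d) ^ n)⁻¹ := by
          gcongr
          linarith
  · rw [setIntegral_eq_integral_of_forall_compl_eq_zero fun y hy =>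
      image_eq_zero_of_notMem_tsupport fun h => hy (hsub h), integral_smul, hint, smul_zero]

theorem hardyNorm_congr_ae {A b : ℝ} {f g : E → 𝕜} (h : f =ᵐ[volume] g) :
    hardyNorm A b f = hardyNorm A b g := by
  rw [hardyNorm, hardyNorm, grandMaximal_congr_ae h]

theorem levelSet_congr_ae {A b : ℝ} {f g : E → 𝕜} (h : f =ᵐ[volume] g) :
    levelSet A b f = levelSet A b g := by
  funext m
  rw [levelSet, levelSet, grandMaximal_congr_ae h]

theorem distCompl_congr_ae {A b : ℝ} {f g : E → 𝕜} (h : f =ᵐ[volume] g) :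
    distCompl A b f = distCompl A b g := by
  funext m x
  rw [distCompl, distCompl, levelSet_congr_ae h]

theorem coeff_congr_ae {A b : ℝ} {f g : E → 𝕜} (h : f =ᵐ[volume] g) :
    coeff A b f = coeff A b g := by
  funext C' m x
  rw [coeff, coeff, distCompl_congr_ae h]

theorem ae_grandMaximal_ne_top {A b : ℝ} {f : E → 𝕜} (hf : hardyNorm A b f < ⊤) :
    ∀ᵐ x, grandMaximal A b f x ≠ ⊤ := by
  filter_upwards [ae_lt_top (measurable_grandMaximal f) hf.ne] with x hx
  exact hx.ne

/-! ### The decomposition theorem and the passage to the atomic norm. -/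

variable (𝕜) in
/-- The atomic decomposition of functions in the Hardy space at all dyadic levels of the grand
maximal function. -/
theorem exists_hardy_decomposition (hn : 1 ≤ n) {A b : ℝ} (hA : 0 < A) (hb : 1 < b) :
    ∃ (cs cs' : ℝ) (N : ℕ) (C C' : ℝ), 0 < cs ∧ cs < cs' ∧ cs' < 1 ∧ 0 < C ∧ 0 < C' ∧
      ∀ f : E → 𝕜, MemHardy A b f →
        ∃ (J : ℤ → Set ℕ) (x : ℤ → ℕ → E) (β : ℤ → ℕ → E → 𝕜),
          Tendsto (fun F : Finset (Σ m : ℤ, J m) =>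
              eLpNorm (fun y => f y - ∑ i ∈ F, β i.1 i.2 y) 1 volume) atTop (𝓝 0) ∧
          (∀ m, ∀ j ∈ J m, x m j ∈ levelSet A b f m ∧
            tsupport (β m j) ⊆ Metric.ball (x m j) (cs * distCompl A b f m (x m j))) ∧
          (∀ m, ∀ j ∈ J m, ∀ y, ‖β m j y‖ ≤ C * (2 : ℝ) ^ m) ∧
          (∀ m, ∀ j ∈ J m, 0 < coeff A b f C' m (x m j) ∧
            IsAtom ⊤ (fun y => (coeff A b f C' m (x m j))⁻¹ • β m j y)) ∧
          (∑' i : Σ m : ℤ, J m, ENNReal.ofReal (coeff A b f C' i.1 (x i.1 i.2))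
            ≤ ENNReal.ofReal C * hardyNorm A b f) ∧
          (∀ m, ∀ y : E, {j | j ∈ J m ∧ y ∈
              Metric.ball (x m j) (cs' * distCompl A b f m (x m j))}.encard ≤ N) ∧
          (Continuous f → ∀ m, ∀ j ∈ J m,
            Continuous (fun y => (coeff A b f C' m (x m j))⁻¹ • β m j y)) ∧
          (∀ p : ℝ≥0∞, 1 < p → p < ⊤ → MemLp f p volume →
            Tendsto (fun F : Finset (Σ m : ℤ, J m) =>
              eLpNorm (fun y => f y - ∑ i ∈ F, β i.1 i.2 y) p volume) atTop (𝓝 0)) := by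
  have hv := unitVol_pos (n := n)
  obtain ⟨K, c, hK, hc, hW⟩ := exists_whitneyPartition n
  obtain ⟨C₀, hC₀, hpt⟩ := exists_enorm_le_grandMaximal n 𝕜 hA hb
  obtain ⟨D, _, hDt, hD⟩ := exists_tsum_zpow_lt_le_one
  set B : ℝ := 4 * (C₀ + 3 * K / (A * c)) with hB
  have hB0 : 0 < B := by positivity
  set C' : ℝ := B * unitVol n with hC'
  have hC'0 : 0 < C' := by positivity
  set C : ℝ := max B (C' * 128 ^ n / unitVol n * D.toReal) with hC
  have hCD : ENNReal.ofReal (C' * 128 ^ n / unitVol n) * D ≤ ENNReal.ofReal C := by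
    rw [← ENNReal.ofReal_toReal hDt, ← ENNReal.ofReal_mul (by positivity)]
    exact ENNReal.ofReal_le_ofReal (le_max_right _ _)
  refine ⟨3 / 8, 1 / 2, 1024 ^ n, C, C', by norm_num, by norm_num, by norm_num,
    lt_max_of_lt_left hB0, hC'0, fun f₁ hf₁ => ?_⟩
  obtain ⟨hae, hcont⟩ := hpt f₁ hf₁.1
  -- The piece bounds must hold at every point, but |f| ≲ Mf holds only almost everywhere. Setting f
  -- to 0 on the exceptional null set leaves Mf and all integrals unchanged, and changes nothing
  -- when f is continuous.
  set f : E → 𝕜 := Set.indicator {x | ‖f₁ x‖ₑ ≤ ENNReal.ofReal C₀ * grandMaximal A b f₁ x} f₁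
    with hfdef
  have hff : f₁ =ᵐ[volume] f := by
    filter_upwards [hae] with x hx
    rw [hfdef, Set.indicator_of_mem (by exact hx)]
  have hfc : Continuous f₁ → Continuous f := fun h => by
    have : f = f₁ := by
      funext x
      rw [hfdef, Set.indicator_of_mem (by exact hcont h x)]
    rwa [this]
  have hfl : LocallyIntegrable f volume := fun x => (hf₁.1 x).congr hff
  have hfb : ∀ x, ‖f x‖ₑ ≤ ENNReal.ofReal C₀ * grandMaximal A b f x := by
    intro x
    rw [← grandMaximal_congr_ae hff, hfdef]
    by_cases hx : ‖f₁ x‖ₑ ≤ ENNReal.ofReal C₀ * grandMaximal A b f₁ x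
    · rwa [Set.indicator_of_mem (by exact hx)]
    · rw [Set.indicator_of_notMem (by exact hx), enorm_zero]
      exact zero_le
  have hfh : hardyNorm A b f < ⊤ := hardyNorm_congr_ae (A := A) (b := b) hff ▸ hf₁.2
  rw [levelSet_congr_ae hff, distCompl_congr_ae hff, coeff_congr_ae hff, hardyNorm_congr_ae hff]
  have hne : ∀ m, (levelSet A b f m)ᶜ.Nonempty := fun m => compl_levelSet_nonempty hn hfh m
  have hO : ∀ m, IsOpen (levelSet A b f m) := fun m => isOpen_levelSet f m
  have W : ∀ m, WhitneyPartition K c (levelSet A b f m) := fun m =>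
    (hW _ (hO m) (hne m)).some
  have hsub : ∀ m, levelSet A b f (m + 1) ⊆ levelSet A b f m := fun m =>
    levelSet_antitone f (by omega)
  set β : ℤ → ℕ → E → 𝕜 := fun m j => (W (m + 1)).piece (W m) f j with hβ
  have hpos : ∀ m, ∀ j ∈ (W m).index, 0 < distCompl A b f m ((W m).center j) := fun m j hj =>
    infDist_compl_pos (hO m) (hne m) ((W m).center_mem j hj)
  have hsupp : ∀ m, ∀ j ∈ (W m).index, tsupport (β m j) ⊆
      Metric.ball ((W m).center j) (3 / 8 * distCompl A b f m ((W m).center j)) := fun m j hj =>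
    (W (m + 1)).tsupport_piece_subset (W m) (hO _) (hne _) (hO _) (hne _) (hsub m) f hj
  have hsize : ∀ m, ∀ j ∈ (W m).index, ∀ y, ‖β m j y‖ ≤ B * (2 : ℝ) ^ m := fun m j hj y =>
    norm_piece_le_of_levelSet hA hb hK hc hC₀ hfb hne W hj y
  have hmeas : ∀ m j, AEStronglyMeasurable (β m j) := fun m j =>
    (W (m + 1)).aestronglyMeasurable_piece (W m) (hO _) (hne _) hfl j
  have hint : ∀ m, ∀ j ∈ (W m).index, ∫ y, β m j y = 0 := by
    intro m j hj
    refine (W (m + 1)).integral_piece (W m) (hO _) (hne _) (hO _) (hne _) hc hfl j ?_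
    refine (Measure.integrableOn_of_bounded (M := B * 2 ^ m)
      (measure_ball_lt_top (x := (W m).center j)
        (r := 3 / 8 * distCompl A b f m ((W m).center j))).ne (hmeas m j)
      (Eventually.of_forall (hsize m j hj))).integrable_of_forall_notMem_eq_zero fun y hy => ?_
    exact image_eq_zero_of_notMem_tsupport fun h => hy (hsupp m j hj h)
  have hconv : ∀ p : ℝ≥0∞, 1 ≤ p → p ≠ ⊤ →
      ∫⁻ x, grandMaximal A b f x ^ p.toReal ≠ ⊤ →
      Tendsto (fun F : Finset (Σ m : ℤ, (W m).index) =>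
        eLpNorm (fun y => f₁ y - ∑ i ∈ F, β i.1 i.2 y) p volume) atTop (𝓝 0) := by
    intro p hp hpt hM
    refine (tendsto_eLpNorm_sub_sum (F := fun (i : Σ m : ℤ, (W m).index) y => β i.1 i.2 y)
      hp hpt (fun i => hmeas i.1 i.2) hfl.aestronglyMeasurable ?_ ENNReal.ofReal_ne_top ?_ hfb
      (tsum_enorm_piece_le hA hb hK hc hC₀ hfb hne W hD) hM).congr fun F => ?_
    · filter_upwards [ae_grandMaximal_ne_top hfh] with y hy
      exact hasSum_piece_of_grandMaximal_ne_top hA hb hK hc hC₀ hfl hfb hne W hy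
    · exact ENNReal.mul_ne_top (ENNReal.mul_ne_top (ENNReal.natCast_ne_top _)
        ENNReal.ofReal_ne_top) hDt
    · refine eLpNorm_congr_ae ?_
      filter_upwards [hff] with y hy
      rw [hy]
  refine ⟨fun m => (W m).index, fun m => (W m).center, β, ?_, fun m j hj => ?_,
    fun m j hj y => ?_, fun m j hj => ⟨?_, ?_⟩, ?_, fun m y => ?_, fun hf m j hj => ?_,
    fun p hp hpt hfp => ?_⟩
  · refine hconv 1 le_rfl ENNReal.one_ne_top ?_
    simpa [hardyNorm] using hfh.ne
  · exact ⟨(W m).center_mem j hj, hsupp m j hj⟩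
  · refine (hsize m j hj y).trans ?_
    gcongr
    exact le_max_left _ _
  · have := hpos m j hj
    rw [coeff]
    positivity
  · exact isAtom_inv_smul_of_norm_le hB0 (by positivity) (hpos m j hj) (hmeas m j)
      (hsupp m j hj) (hsize m j hj) (hint m j hj)
  · exact (tsum_coeff_le hC'0 hne W hD).trans (mul_le_mul' hCD le_rfl)
  · exact encard_whitney_le (W m).pairwiseDisjoint y
  · exact ((W (m + 1)).continuous_piece (W m) (hO _) (hne _) hc (hfc hf) j).const_smul _
  · refine hconv p hp.le hpt.ne ?_
    have hp0 : p ≠ 0 := (zero_lt_one.trans hp).ne'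
    refine (lintegral_grandMaximal_rpow_lt_top hn hA hb hfl.aestronglyMeasurable
      (ae_grandMaximal_ne_top hfh) ?_ ?_).ne
    · rw [← ENNReal.toReal_one]
      exact (ENNReal.toReal_lt_toReal ENNReal.one_ne_top hpt.ne).mpr hp
    · exact lintegral_rpow_enorm_lt_top_of_eLpNorm_lt_top hp0 hpt.ne
        ((memLp_congr_ae hff).mp hfp).2

theorem MemHardy.integrable {A b : ℝ} (hA : 0 < A) (hb : 1 < b) {f : E → 𝕜}
    (hf : MemHardy A b f) : Integrable f := by
  obtain ⟨C, _, hC⟩ := exists_enorm_le_grandMaximal n 𝕜 hA hb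
  refine ⟨hf.1.aestronglyMeasurable, ?_⟩
  refine lt_of_le_of_lt (lintegral_mono_ae (hC f hf.1).1) ?_
  rw [lintegral_const_mul' _ _ ENNReal.ofReal_ne_top]
  exact ENNReal.mul_lt_top ENNReal.ofReal_lt_top hf.2

/-- A countable family of atoms can be rearranged into a sequence. -/
theorem exists_isAtomicDecomposition {ι : Type*} [Countable ι] {f : E → 𝕜}
    {μ : ι → ℝ} {β : ι → E → 𝕜} (hμ : ∀ i, 0 < μ i)
    (hatom : ∀ i, IsAtom ⊤ (fun y => (μ i)⁻¹ • β i y))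
    (hsum : ∑' i, ENNReal.ofReal (μ i) ≠ ⊤)
    (hlim : Tendsto (fun F : Finset ι => eLpNorm (fun y => f y - ∑ i ∈ F, β i y) 1 volume)
      atTop (𝓝 0)) :
    ∃ lam a, IsAtomicDecomposition ⊤ f lam a ∧ ∑' j, ‖lam j‖ₑ = ∑' i, ENNReal.ofReal (μ i) := by
  classical
  obtain ⟨e, he⟩ := exists_injective_nat ι
  -- Indices outside the range of e receive coefficient 0 and the zero atom. Unconditional
  -- convergence makes the order induced by e harmless.
  set lam : ℕ → 𝕜 := Function.extend e (fun i => (μ i : 𝕜)) 0 with hlam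
  set a : ℕ → E → 𝕜 := Function.extend e (fun i y => (μ i)⁻¹ • β i y) 0 with ha
  have hlam1 : ∀ i, lam (e i) = μ i := fun i => he.extend_apply _ _ i
  have ha1 : ∀ i, a (e i) = fun y => (μ i)⁻¹ • β i y := fun i => he.extend_apply _ _ i
  have hlam0 : ∀ k, k ∉ Set.range e → lam k = 0 := fun k hk => Function.extend_apply' _ _ _ hk
  have ha0 : ∀ k, k ∉ Set.range e → a k = 0 := fun k hk => Function.extend_apply' _ _ _ hk
  have htsum : ∑' j, ‖lam j‖ₑ = ∑' i, ENNReal.ofReal (μ i) := by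
    rw [← he.tsum_eq (f := fun j => ‖lam j‖ₑ)]
    · congr 1 with i
      rw [hlam1, ← ofReal_norm, RCLike.norm_ofReal, abs_of_pos (hμ i)]
    · intro k hk
      by_contra h
      exact hk (by simp [hlam0 k h])
  refine ⟨lam, a, ⟨fun k => ?_, ?_, ?_⟩, htsum⟩
  · by_cases hk : k ∈ Set.range e
    · obtain ⟨i, rfl⟩ := hk
      rw [ha1]
      exact hatom i
    · rw [ha0 k hk]
      exact isAtom_zero
  · exact tsum_enorm_ne_top_iff_summable_norm.mp (htsum ▸ hsum)
  · have h := hlim.comp ((Filter.tendsto_finset_preimage_atTop_atTop he).comp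
      tendsto_finset_range)
    refine h.congr fun k => ?_
    simp only [Function.comp_apply]
    congr 1
    funext y
    congr 1
    rw [← Finset.sum_preimage e (Finset.range k) he.injOn (fun j => lam j * a j y)
      fun j _ hj => by rw [hlam0 j hj, zero_mul]]
    refine Finset.sum_congr rfl fun i _ => ?_
    rw [hlam1, ha1, ← RCLike.real_smul_eq_coe_mul, smul_inv_smul₀ (hμ i).ne']

end HardyAtomic

end


theorem proposition6p7 {𝕜 : Type*} [RCLike 𝕜] (n : ℕ) (hn : 1 ≤ n)
    (A b : ℝ) (hA : 0 < A) (hb : 1 < b) :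
    -- continuous inclusion of the Hardy space in the atomic Hardy space
    (∃ C : ℝ, 0 < C ∧ ∀ f : EuclideanSpace ℝ (Fin n) → 𝕜, HardyAtomic.MemHardy A b f →
      HardyAtomic.MemAtomicHardy ⊤ f ∧
      HardyAtomic.atomicHardyNorm ⊤ f ≤ ENNReal.ofReal C * HardyAtomic.hardyNorm A b f) ∧
    -- the refined decomposition
    ∃ (cs cs' : ℝ) (N : ℕ) (C C' : ℝ), 0 < cs ∧ cs < cs' ∧ cs' < 1 ∧ 0 < C ∧ 0 < C' ∧
      ∀ f : EuclideanSpace ℝ (Fin n) → 𝕜, HardyAtomic.MemHardy A b f →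
        ∃ (J : ℤ → Set ℕ) (x : ℤ → ℕ → EuclideanSpace ℝ (Fin n))
          (β : ℤ → ℕ → EuclideanSpace ℝ (Fin n) → 𝕜),
          -- convergence of the decomposition in `L^1`
          Tendsto (fun F : Finset (Σ m : ℤ, J m) =>
              eLpNorm (fun y => f y - ∑ i ∈ F, β i.1 i.2 y) 1 volume) atTop (𝓝 0) ∧
          -- supports
          (∀ m, ∀ j ∈ J m, x m j ∈ HardyAtomic.levelSet A b f m ∧
            tsupport (β m j) ⊆
              Metric.ball (x m j) (cs * HardyAtomic.distCompl A b f m (x m j))) ∧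
          -- size
          (∀ m, ∀ j ∈ J m, ∀ y, ‖β m j y‖ ≤ C * (2 : ℝ) ^ m) ∧
          -- the normalized pieces are atoms
          (∀ m, ∀ j ∈ J m, 0 < HardyAtomic.coeff A b f C' m (x m j) ∧
            HardyAtomic.IsAtom ⊤
              (fun y => (HardyAtomic.coeff A b f C' m (x m j))⁻¹ • β m j y)) ∧
          -- sum of the coefficients
          (∑' i : Σ m : ℤ, J m, ENNReal.ofReal (HardyAtomic.coeff A b f C' i.1 (x i.1 i.2))
            ≤ ENNReal.ofReal C * HardyAtomic.hardyNorm A b f) ∧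
          -- bounded intersection property
          (∀ m, ∀ y : EuclideanSpace ℝ (Fin n),
            {j | j ∈ J m ∧ y ∈
              Metric.ball (x m j) (cs' * HardyAtomic.distCompl A b f m (x m j))}.encard ≤ N) ∧
          -- continuity of the atoms
          (Continuous f → ∀ m, ∀ j ∈ J m,
            Continuous (fun y => (HardyAtomic.coeff A b f C' m (x m j))⁻¹ • β m j y)) ∧
          -- convergence in `L^p`
          (∀ p : ℝ≥0∞, 1 < p → p < ⊤ → MemLp f p volume →
            Tendsto (fun F : Finset (Σ m : ℤ, J m) =>
              eLpNorm (fun y => f y - ∑ i ∈ F, β i.1 i.2 y) p volume) atTop (𝓝 0)) := by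
  have hdec := HardyAtomic.exists_hardy_decomposition (n := n) 𝕜 hn hA hb
  refine ⟨?_, hdec⟩
  obtain ⟨cs, cs', N, C, C', -, -, -, hC, hC', h⟩ := hdec
  refine ⟨C, hC, fun f hf => ?_⟩
  obtain ⟨J, x, β, hlim, -, -, hatom, hsum, -⟩ := h f hf
  have hfin : ENNReal.ofReal C * HardyAtomic.hardyNorm A b f < ⊤ :=
    ENNReal.mul_lt_top ENNReal.ofReal_lt_top hf.2
  obtain ⟨lam, a, hla, htsum⟩ := HardyAtomic.exists_isAtomicDecomposition
    (fun i : Σ m : ℤ, J m => (hatom i.1 i.2 i.2.2).1)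
    (fun i : Σ m : ℤ, J m => (hatom i.1 i.2 i.2.2).2) (ne_top_of_le_ne_top hfin.ne hsum) hlim
  refine ⟨⟨hf.integrable hA hb, lam, a, hla⟩, ?_⟩
  refine le_trans ?_ hsum
  rw [← htsum]
  exact iInf_le_of_le lam (iInf_le_of_le a (iInf_le_of_le hla le_rfl))
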